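/- Let $\mathcal H$ be a finite-dimensional complex Hilbert space of dimension $d$, $\mathcal B(\mathcal H)$ its algebra of operators and $\mathcal S(\mathcal H)$ the set of states (positive operators of trace one). Let $\mathcal P=(\mathcal P_t)_{t\ge 0}$ be a quantum Markov semigroup on $\mathcal B(\mathcal H)$: a continuous one-parameter semigroup, $\mathcal P_0=\mathrm{id}$, of completely positive linear maps with $\mathcal P_t(I)=I$. Let $\mathcal L=\lim_{t\to0^+}\frac1t(\mathcal P_t-\mathrm{id})$ be its Lindbladian. For a linear map $\Phi$ on $\mathcal B(\mathcal H)$ its predual $\Phi_*$ is defined by $\operatorname{Tr}[\Phi(X)Y]=\operatorname{Tr}[X\,\Phi_*(Y)]$ for all $X,Y$; write $\mathcal P_{*t}$ and $\mathcal L_*$ for the preduals of $\mathcal P_t$ and $\mathcal L$. Assume that $\mathcal P$ has a faithful invariant state $\sigma$, i.e. $\sigma\in\mathcal S(\mathcal H)$, $\sigma>0$, and $\operatorname{Tr}[\sigma\mathcal P_t(X)]=\operatorname{Tr}[\sigma X]$ for all $t\ge0$ and $X$. The decoherence-free algebra $\mathcal N(\mathcal P)$ is the set of all $X\in\mathcal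 B(\mathcal H)$ such that $\mathcal P_t(X^*Y)=\mathcal P_t(X)^*\mathcal P_t(Y)$ and $\mathcal P_t(YX^*)=\mathcal P_t(Y)\mathcal P_t(X)^*$ for all $t\ge0$ and $Y\in\mathcal B(\mathcal H)$. There is a unique completely positive projection $E_{\mathcal N}$ on $\mathcal B(\mathcal H)$ with $\operatorname{Tr}[\sigma E_{\mathcal N}(X)]=\operatorname{Tr}[\sigma X]$ for all $X$, with image $\mathcal N(\mathcal P)$, and such that $E_{\mathcal N}(X)=0$ if and only if $\lim_{t\to\infty}\mathcal P_t(X)=0$. Put $\sigma_{\operatorname{Tr}}=E_{\mathcal N*}(I/d)$, let $\sigma_{\min}$ be its smallest eigenvalue, and let $\langle X,Y\rangle=\operatorname{Tr}[\sigma_{\operatorname{Tr}}^{1/2}X^*\sigma_{\operatorname{Tr}}^{1/2}Y]$ and $\|X\|_2^2=\langle X,X\rangle$. Let $\lambda(\mathcal L)\in[0,+\infty]$ be the best (largest) constant $\lambda$ in $$\lambda\,\|X-E_{\mathcal N}(X)\|_2^2\le-\langle X,\mathcal L(X)\rangle\qquad\text{for all self-adjoint }X\in\mathcal B(\mathcal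 H).$$ Let $D(\rho\|\tau)=\operatorname{Tr}[\rho(\log\rho-\log\tau)]$ if $\operatorname{supp}\rho\subseteq\operatorname{supp}\tau$ and $+\infty$ otherwise, and let $\operatorname{EP}(\rho)=-\operatorname{Tr}[\mathcal L_*(\rho)(\log\rho-\log\sigma_{\operatorname{Tr}})]$ for $\rho\in\mathcal S(\mathcal H)$, where for non-faithful $\rho$ one uses $\log0=-\infty$ and $0\log 0=0$ (so that $\operatorname{EP}(\rho)=+\infty$ unless the compression of $\mathcal L_*(\rho)$ to $\ker\rho$ vanishes). Let $$\alpha_{\mathcal N}(\mathcal L)=\inf\Big\{\frac{\operatorname{EP}(\rho)}{2\,D(\rho\|E_{\mathcal N*}(\rho))}\;:\;\rho\in\mathcal S(\mathcal H),\ \rho\ne E_{\mathcal N*}(\rho)\Big\}\in[0,+\infty].$$ Let $\|X\|_{\operatorname{Tr}}=\operatorname{Tr}\sqrt{X^*X}$. Then for every $\rho\in\mathcal S(\mathcal H)$ and every $t\ge0$, $$\|\mathcal P_{*t}(\rho-E_{\mathcal N*}(\rho))\|_{\operatorname{Tr}}\le\sqrt{1/\sigma_{\min}}\;e^{-\lambda(\mathcal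 L)t}$$ and $$\|\mathcal P_{*t}(\rho-E_{\mathcal N*}(\rho))\|_{\operatorname{Tr}}\le\sqrt{2\log(1/\sigma_{\min})}\;e^{-\alpha_{\mathcal N}(\mathcal L)t}.$$ (If $\mathcal N(\mathcal P)=\mathcal B(\mathcal H)$ both constants are $+\infty$; conventions $\infty\cdot0=0$ and $e^{-\infty}=0$.) -/

import Mathlib

open scoped NNReal ENNReal InnerProductSpace Topology CStarAlgebra

set_option linter.unusedSectionVars false

noncomputable section

namespace QMS

variable {H : Type*} [NormedAddCommGroup H] [InnerProductSpace ℂ H] [CompleteSpace H]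

/-- The trace of an operator on a finite dimensional Hilbert space. -/
def tr (X : H →L[ℂ] H) : ℂ := LinearMap.trace ℂ H (X : H →ₗ[ℂ] H)

/-- Density matrices (states): positive operators of trace one. -/
def IsState (ρ : H →L[ℂ] H) : Prop := 0 ≤ ρ ∧ tr ρ = 1

/-- The trace norm `Tr √(X* X)`. -/
def traceNorm (X : H →L[ℂ] H) : ℝ := (tr (CFC.abs X)).re

/-- The smallest (real) eigenvalue of an operator; it is used for positive operators on a nonzero
finite dimensional space, whose eigenvalues form a finite nonempty set of nonnegative reals. -/
def minEigenvalue (X : H →L[ℂ] H) : ℝ :=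
  sInf {μ : ℝ | Module.End.HasEigenvalue (X : H →ₗ[ℂ] H) (μ : ℂ)}

/-- The relative entropy `D(ρ‖τ) = Tr[ρ (log ρ - log τ)]` if `supp ρ ⊆ supp τ`, and `+∞` otherwise.
`CFC.log` is the logarithm on the support, extended by zero. -/
def relEntropy (ρ τ : H →L[ℂ] H) : EReal :=
  open Classical in
  if ∀ x, τ x = 0 → ρ x = 0 then ((tr (ρ * (CFC.log ρ - CFC.log τ))).re : EReal) else ⊤

/-- The scalar product `⟨X, Y⟩_σ = Tr[σ^{1/2} X* σ^{1/2} Y]`. -/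
def weightedInner (σ X Y : H →L[ℂ] H) : ℂ := tr (CFC.sqrt σ * star X * CFC.sqrt σ * Y)

section Predual

variable [FiniteDimensional ℂ H]

/-- The predual `Φ_*` of a linear map `Φ` on `B(H)`, given by its matrix entries in an orthonormal
basis. It is characterised by `Tr[Φ(X) Y] = Tr[X Φ_*(Y)]`, see `tr_map_mul` and
`predual_unique`. -/
def predual (Φ : (H →L[ℂ] H) →ₗ[ℂ] (H →L[ℂ] H)) : (H →L[ℂ] H) →ₗ[ℂ] (H →L[ℂ] H) where
  toFun Y := ∑ i, ∑ j,
    tr (Φ (InnerProductSpace.rankOne ℂ (stdOrthonormalBasis ℂ H j) (stdOrthonormalBasis ℂ H i)) * Y)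
      • InnerProductSpace.rankOne ℂ (stdOrthonormalBasis ℂ H i) (stdOrthonormalBasis ℂ H j)
  map_add' Y Z := by
    simp [tr, mul_add, add_smul, Finset.sum_add_distrib]
  map_smul' c Y := by
    simp [tr, Finset.smul_sum, mul_smul]

lemma tr_rankOne_mul (x y : H) (Z : H →L[ℂ] H) :
    tr (InnerProductSpace.rankOne ℂ x y * Z) = ⟪y, Z x⟫_ℂ := by
  rw [tr, ContinuousLinearMap.toLinearMap_mul, LinearMap.trace_mul_comm,
    ← ContinuousLinearMap.toLinearMap_mul, ContinuousLinearMap.mul_def,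
    InnerProductSpace.comp_rankOne, InnerProductSpace.trace_rankOne]

lemma eq_sum_rankOne (Z : H →L[ℂ] H) :
    Z = ∑ i, ∑ j, ⟪stdOrthonormalBasis ℂ H i, Z (stdOrthonormalBasis ℂ H j)⟫_ℂ •
      InnerProductSpace.rankOne ℂ (stdOrthonormalBasis ℂ H i) (stdOrthonormalBasis ℂ H j) := by
  ext x
  conv_lhs => rw [← (stdOrthonormalBasis ℂ H).sum_repr' (Z x)]
  simp only [sum_apply, smul_apply,
    InnerProductSpace.rankOne_apply]
  refine Finset.sum_congr rfl fun i _ => ?_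
  conv_lhs => rw [← (stdOrthonormalBasis ℂ H).sum_repr' x]
  simp only [map_sum, map_smul, inner_sum, inner_smul_right, Finset.sum_smul, smul_smul]
  exact Finset.sum_congr rfl fun j _ => by rw [mul_comm]

lemma tr_map_mul (Φ : (H →L[ℂ] H) →ₗ[ℂ] (H →L[ℂ] H)) (X Y : H →L[ℂ] H) :
    tr (Φ X * Y) = tr (X * predual Φ Y) := by
  have hX : ∀ i j, tr (X * InnerProductSpace.rankOne ℂ (stdOrthonormalBasis ℂ H i)
      (stdOrthonormalBasis ℂ H j)) =
      ⟪stdOrthonormalBasis ℂ H j, X (stdOrthonormalBasis ℂ H i)⟫_ℂ := by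
    intro i j
    rw [← tr_rankOne_mul, tr, tr, ContinuousLinearMap.toLinearMap_mul, LinearMap.trace_mul_comm,
      ← ContinuousLinearMap.toLinearMap_mul]
  have h1 : tr (X * predual Φ Y) = ∑ i, ∑ j, tr (Φ (InnerProductSpace.rankOne ℂ
      (stdOrthonormalBasis ℂ H j) (stdOrthonormalBasis ℂ H i)) * Y) *
        ⟪stdOrthonormalBasis ℂ H j, X (stdOrthonormalBasis ℂ H i)⟫_ℂ := by
    simp only [← hX]
    simp [predual, tr, Finset.mul_sum]
  have h2 : tr (Φ X * Y) = ∑ j, ∑ i, tr (Φ (InnerProductSpace.rankOne ℂ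
      (stdOrthonormalBasis ℂ H j) (stdOrthonormalBasis ℂ H i)) * Y) *
        ⟪stdOrthonormalBasis ℂ H j, X (stdOrthonormalBasis ℂ H i)⟫_ℂ := by
    conv_lhs => rw [eq_sum_rankOne X]
    simp [tr, Finset.sum_mul, mul_comm]
  rw [h1, h2, Finset.sum_comm]

lemma predual_unique (Φ Ψ : (H →L[ℂ] H) →ₗ[ℂ] (H →L[ℂ] H))
    (h : ∀ X Y, tr (Φ X * Y) = tr (X * Ψ Y)) : Ψ = predual Φ := by
  ext Y x
  refine ext_inner_left ℂ fun y => ?_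
  rw [← tr_rankOne_mul, ← tr_rankOne_mul, ← h, tr_map_mul]

end Predual

end QMS

/-- A (continuous) quantum Markov semigroup on `B(H)` in the Heisenberg picture: a continuous
semigroup of completely positive maps which preserve the identity operator. -/
structure QuantumMarkovSemigroup (H : Type*) [NormedAddCommGroup H] [InnerProductSpace ℂ H]
    [CompleteSpace H] where
  map : ℝ≥0 → ((H →L[ℂ] H) →CP (H →L[ℂ] H))
  map_one : ∀ t, map t 1 = 1
  map_zero : ∀ X, map 0 X = X
  map_add : ∀ s t X, map (s + t) X = map s (map t X)
  continuous : ∀ X, Continuous fun t => map t X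

namespace QMS

variable {H : Type*} [NormedAddCommGroup H] [InnerProductSpace ℂ H] [CompleteSpace H]

/-- The Lindbladian `ℒ(X) = lim_{t → 0⁺} (P_t(X) - X) / t`. -/
def lindbladian (P : QuantumMarkovSemigroup H) (X : H →L[ℂ] H) : H →L[ℂ] H :=
  derivWithin (fun t : ℝ => P.map t.toNNReal X) (Set.Ici 0) 0

/-- `σ` is an invariant state: `σ(P_t(X)) = σ(X)` for all `t` and `X`. -/
def IsInvariantState (P : QuantumMarkovSemigroup H) (σ : H →L[ℂ] H) : Prop :=
  IsState σ ∧ ∀ t X, tr (σ * P.map t X) = tr (σ * X)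

/-- The decoherence-free algebra `N(P)`. -/
def dfAlgebra (P : QuantumMarkovSemigroup H) : Set (H →L[ℂ] H) :=
  {X | ∀ t Y, P.map t (star X * Y) = star (P.map t X) * P.map t Y ∧
    P.map t (Y * star X) = P.map t Y * star (P.map t X)}

/-- `E` is the conditional expectation onto the decoherence-free algebra: a completely positive
projection compatible with the state `σ`, whose image is `N(P)` and whose kernel consists of the
observables that vanish in the long time. -/
structure IsDFExpectation (P : QuantumMarkovSemigroup H) (σ : H →L[ℂ] H)
    (E : (H →L[ℂ] H) →CP (H →L[ℂ] H)) : Prop where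
  idempotent : ∀ X, E (E X) = E X
  compatible : ∀ X, tr (σ * E X) = tr (σ * X)
  range_eq : Set.range E = dfAlgebra P
  ker_iff : ∀ X, E X = 0 ↔ Filter.Tendsto (fun t => P.map t X) Filter.atTop (𝓝 0)

variable [FiniteDimensional ℂ H]

/-- The predual semigroup `P_{*t}` (Schrödinger picture). -/
def predualMap (P : QuantumMarkovSemigroup H) (t : ℝ≥0) : (H →L[ℂ] H) →ₗ[ℂ] (H →L[ℂ] H) :=
  predual (P.map t).toLinearMap

/-- The generator `ℒ_*` of the predual semigroup. -/
def predualLindbladian (P : QuantumMarkovSemigroup H) (ρ : H →L[ℂ] H) : H →L[ℂ] H :=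
  derivWithin (fun t : ℝ => predualMap P t.toNNReal ρ) (Set.Ici 0) 0

/-- The predual `E_*` of a conditional expectation `E`. -/
def predualExp (E : (H →L[ℂ] H) →CP (H →L[ℂ] H)) : (H →L[ℂ] H) →ₗ[ℂ] (H →L[ℂ] H) :=
  predual E.toLinearMap

/-- The reference state `σ_Tr = E_*(I / d)`, with `d = dim H`. -/
def refState (E : (H →L[ℂ] H) →CP (H →L[ℂ] H)) : H →L[ℂ] H :=
  predualExp E ((Module.finrank ℂ H : ℂ)⁻¹ • (1 : H →L[ℂ] H))

/-- The decoherence-free variance `‖X - E(X)‖²`, for the norm of the scalar product `⟨·,·⟩_σ`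
with `σ = σ_Tr`. -/
def dfVariance (E : (H →L[ℂ] H) →CP (H →L[ℂ] H)) (X : H →L[ℂ] H) : ℝ :=
  (weightedInner (refState E) (X - E X) (X - E X)).re

/-- The Dirichlet form `-⟨X, ℒ(X)⟩_σ` with `σ = σ_Tr`; this number is real when `X` is
self-adjoint. -/
def dirichletForm (P : QuantumMarkovSemigroup H) (E : (H →L[ℂ] H) →CP (H →L[ℂ] H))
    (X : H →L[ℂ] H) : ℝ :=
  -(weightedInner (refState E) X (lindbladian P X)).re

/-- `λ(ℒ)`: the best constant in the decoherence-free Poincaré inequality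
`λ Var_N(X) ≤ ℰ(X)` for all self-adjoint `X` (it is `+∞` if `Var_N` vanishes identically). -/
def poincareConst (P : QuantumMarkovSemigroup H) (E : (H →L[ℂ] H) →CP (H →L[ℂ] H)) : EReal :=
  sSup {l : EReal | ∃ c : ℝ, l = (c : EReal) ∧
    ∀ X : H →L[ℂ] H, IsSelfAdjoint X → c * dfVariance E X ≤ dirichletForm P E X}

/-- The entropy production `-Tr[ℒ_*(ρ) (log ρ - log σ)]` with `σ = σ_Tr`. If `ρ` is not faithful,
`-Tr[ℒ_*(ρ) log ρ]` is read with `log 0 = -∞` and `0 · log 0 = 0`: as the compression of `ℒ_*(ρ)`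
to the kernel of `ρ` is positive semidefinite, the value is `+∞` unless this compression vanishes,
and the finite value in that case is given by the logarithm on the support of `ρ`. -/
def entropyProduction (P : QuantumMarkovSemigroup H) (E : (H →L[ℂ] H) →CP (H →L[ℂ] H))
    (ρ : H →L[ℂ] H) : EReal :=
  open Classical in
  if ∀ x, ρ x = 0 → ⟪x, predualLindbladian P ρ x⟫_ℂ = 0 then
    ((-(tr (predualLindbladian P ρ * (CFC.log ρ - CFC.log (refState E)))).re : ℝ) : EReal)
  else ⊤

/-- The decoherence-free relative entropy `D(ρ‖E_*(ρ))`. -/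
def dfEntropy (E : (H →L[ℂ] H) →CP (H →L[ℂ] H)) (ρ : H →L[ℂ] H) : EReal :=
  relEntropy ρ (predualExp E ρ)

/-- `α_N(ℒ)`: the best constant in the modified decoherence-free log-Sobolev inequality
`2 α D_N(ρ) ≤ EP(ρ)`, that is, the infimum of `EP(ρ) / (2 D_N(ρ))` over the states `ρ` with
`D_N(ρ) ≠ 0`, i.e. `ρ ≠ E_*(ρ)` (it is `+∞` if there are none). -/
def logSobolevConst (P : QuantumMarkovSemigroup H) (E : (H →L[ℂ] H) →CP (H →L[ℂ] H)) : EReal :=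
  ⨅ (ρ : H →L[ℂ] H) (_ : IsState ρ) (_ : ρ ≠ predualExp E ρ),
    entropyProduction P E ρ / (2 * dfEntropy E ρ)

end QMS

end

/-!
Both estimates compare `P_{*t}(ρ - E_*(ρ))` with the reference state `σ_Tr = E_*(I / d)`, and both
rest on the structure of the decoherence-free algebra `N`.

**The conditional expectation.** A limit `Q` of `P_t` along an ultrafilter at infinity is completely
positive, but need not be idempotent. With `Q_s` the limit of `P_{t - s}` in `t` and `R` the limit
of `Q_s` in `s`, one has `P_s Q_s = Q`, hence `Q R = Q`. The semigroup contracts the GNS norm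
of `σ`, so `Q X = 0` exactly when `P_t X → 0`, and `R` has the same kernel; therefore `R` is
idempotent. Its fixed points are the observables whose GNS norm is preserved by all `P_t`, which by
equality in the Kadison-Schwarz inequality and the multiplicative domain argument are the elements
of `N` (`exists_dfExpectation`). Two expectations with the same range and kernel coincide.

**The reference state.** `E` is a bimodule map over `N`, so `σ_Tr` commutes with `N`, and
`E_*(ρ) = σ_Tr ω` with a positive density `ω` in `N` (`exists_density`). On `N` the semigroup acts
by injective star homomorphisms, which preserve the trace: the trace of a projection is an integer,
and a continuous path in the integers is constant (`tr_map_of_mem`). It follows that `σ_Tr` is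
invariant under the semigroup.

**Poincaré inequality.** Test the trace norm against a self-adjoint unitary `U` and move the
evolution to `Y_t = P_t(U - E(U))`. As `E(Y_t) = 0`, the Poincaré inequality and Grönwall's lemma
give `‖Y_t‖² ≤ exp(-2ct) ‖U - E(U)‖² ≤ exp(-2ct)` in the weighted norm of `σ_Tr`, and the weighted
Cauchy-Schwarz inequality (`sq_tr_mul_le_weightedInner`) gives `|Tr[ρ Y_t]|² ≤ ‖Y_t‖² / σ_min`.

**Logarithmic Sobolev inequality.** For faithful `ρ`, the logarithm of `E_*(ρ)` splits as
`log σ_Tr + log ω`, and `Tr[P_{*t}(ρ) log ω_t]` does not depend on time because `P_t` maps the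
density `ω_t` of `E_*(P_{*t}(ρ))` to `ω`. Hence the derivative of `D(ρ_t‖E_*(ρ_t))` is minus the
entropy production (`hasDerivAt_tr_mul_log`), and Grönwall's lemma gives exponential decay from an
initial value of at most `log (1 / σ_min)`. Pinsker's inequality (`pinsker`) turns this into a bound
on the trace norm, and mixing with `σ_Tr` removes the assumption that `ρ` is faithful.

The constants `λ(ℒ)` and `α_N(ℒ)` are extended reals; the estimates are proved for every real rate
below them and for no decay at all, and `ofReal_le_mul_exp` passes to the limit. Differentiability
of the semigroup is not part of its definition and is deduced from continuity (`exists_generator`).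
-/

namespace QMS

/-! ### The trace -/

section Trace

open scoped ComplexOrder
open Polynomial

variable {H : Type*} [NormedAddCommGroup H] [InnerProductSpace ℂ H] [CompleteSpace H]

@[simp] lemma tr_zero : tr (0 : H →L[ℂ] H) = 0 := by simp [tr]

@[simp] lemma tr_add (X Y : H →L[ℂ] H) : tr (X + Y) = tr X + tr Y := by simp [tr]

@[simp] lemma tr_sub (X Y : H →L[ℂ] H) : tr (X - Y) = tr X - tr Y := by simp [tr]

@[simp] lemma tr_smul (c : ℂ) (X : H →L[ℂ] H) : tr (c • X) = c * tr X := by simp [tr]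

@[simp] lemma tr_real_smul (c : ℝ) (X : H →L[ℂ] H) : tr (c • X) = c * tr X := by
  rw [← tr_smul]; rfl

lemma tr_mul_comm (X Y : H →L[ℂ] H) : tr (X * Y) = tr (Y * X) := by
  simp only [tr, ContinuousLinearMap.toLinearMap_mul]
  exact LinearMap.trace_mul_comm ℂ _ _

lemma tr_sum {ι : Type*} (s : Finset ι) (f : ι → H →L[ℂ] H) :
    tr (∑ i ∈ s, f i) = ∑ i ∈ s, tr (f i) := by simp [tr]

lemma tr_eq_sum_inner {ι : Type*} [Fintype ι] (b : OrthonormalBasis ι ℂ H) (X : H →L[ℂ] H) :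
    tr X = ∑ i, ⟪b i, X (b i)⟫_ℂ :=
  LinearMap.trace_eq_sum_inner _ b

lemma nonneg_iff_inner {X : H →L[ℂ] H} : 0 ≤ X ↔ ∀ x, 0 ≤ ⟪x, X x⟫_ℂ := by
  rw [ContinuousLinearMap.nonneg_iff_isPositive]
  refine ⟨fun h x => h.inner_nonneg_right x, fun h => ?_⟩
  rw [ContinuousLinearMap.isPositive_iff_complex]
  intro x
  have h1 := h x
  rw [← inner_conj_symm, ← RCLike.star_def, star_nonneg_iff] at h1
  rw [Complex.nonneg_iff] at h1
  refine ⟨?_, h1.1⟩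
  apply Complex.ext <;> simp [h1.2]

variable [FiniteDimensional ℂ H]

/-- The trace as a continuous linear functional. -/
noncomputable def trCLM : (H →L[ℂ] H) →L[ℂ] ℂ :=
  LinearMap.toContinuousLinearMap { toFun := tr, map_add' := tr_add, map_smul' := tr_smul }

lemma continuous_tr : Continuous (tr : (H →L[ℂ] H) → ℂ) :=
  (trCLM (H := H)).continuous

lemma tr_star (X : H →L[ℂ] H) : tr (star X) = star (tr X) := by
  rw [tr_eq_sum_inner (stdOrthonormalBasis ℂ H), tr_eq_sum_inner (stdOrthonormalBasis ℂ H),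
    star_sum]
  refine Finset.sum_congr rfl fun i _ => ?_
  rw [ContinuousLinearMap.star_eq_adjoint, ContinuousLinearMap.adjoint_inner_right, RCLike.star_def,
    inner_conj_symm]

lemma tr_nonneg {X : H →L[ℂ] H} (hX : 0 ≤ X) : 0 ≤ tr X := by
  rw [tr_eq_sum_inner (stdOrthonormalBasis ℂ H)]
  exact Finset.sum_nonneg fun i _ => nonneg_iff_inner.1 hX _

lemma tr_mul_nonneg {X Y : H →L[ℂ] H} (hX : 0 ≤ X) (hY : 0 ≤ Y) : 0 ≤ tr (X * Y) := by
  obtain ⟨a, rfl⟩ := CStarAlgebra.nonneg_iff_eq_star_mul_self.1 hX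
  rw [mul_assoc, tr_mul_comm]
  exact tr_nonneg (star_right_conjugate_nonneg hY a)

lemma tr_mul_re_nonneg {X Y : H →L[ℂ] H} (hX : 0 ≤ X) (hY : 0 ≤ Y) : 0 ≤ (tr (X * Y)).re :=
  (Complex.nonneg_iff.1 (tr_mul_nonneg hX hY)).1

lemma tr_mul_re_le {X Y Z : H →L[ℂ] H} (hX : 0 ≤ X) (h : Y ≤ Z) :
    (tr (X * Y)).re ≤ (tr (X * Z)).re := by
  have := tr_mul_re_nonneg hX (sub_nonneg.2 h)
  rw [mul_sub, tr_sub, Complex.sub_re] at this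
  linarith

/-- The trace pairing is nondegenerate. -/
lemma ext_tr_mul {A B : H →L[ℂ] H} (h : ∀ X, tr (X * A) = tr (X * B)) : A = B := by
  ext x
  refine ext_inner_left ℂ fun y => ?_
  rw [← tr_rankOne_mul, ← tr_rankOne_mul, h]

/-- The positive cone is self-dual for the trace pairing. -/
lemma nonneg_of_tr_mul {A : H →L[ℂ] H} (h : ∀ X, 0 ≤ X → 0 ≤ tr (X * A)) : 0 ≤ A := by
  rw [nonneg_iff_inner]
  intro x
  rw [← tr_rankOne_mul]
  apply h
  rw [ContinuousLinearMap.nonneg_iff_isPositive]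
  exact InnerProductSpace.isPositive_rankOne_self x

lemma eq_zero_of_tr_star_mul_self {X : H →L[ℂ] H} (h : tr (star X * X) = 0) : X = 0 := by
  rw [tr_eq_sum_inner (stdOrthonormalBasis ℂ H)] at h
  have h2 : ∀ i, ⟪stdOrthonormalBasis ℂ H i, (star X * X) (stdOrthonormalBasis ℂ H i)⟫_ℂ = 0 := by
    intro i
    exact (Finset.sum_eq_zero_iff_of_nonneg fun j _ =>
      nonneg_iff_inner.1 (star_mul_self_nonneg X) _).1 h i (Finset.mem_univ i)
  have h3 : (X : H →ₗ[ℂ] H) = 0 := by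
    refine (stdOrthonormalBasis ℂ H).toBasis.ext fun i => ?_
    have := h2 i
    rw [mul_apply_eq_comp, ContinuousLinearMap.star_eq_adjoint,
      ContinuousLinearMap.adjoint_inner_right, inner_self_eq_zero] at this
    simpa using this
  ext x
  exact congrArg (fun f : H →ₗ[ℂ] H => f x) h3

/-- A strictly positive operator defines a faithful functional. -/
lemma eq_zero_of_tr_mul_eq_zero {σ X : H →L[ℂ] H} (hσ : IsStrictlyPositive σ) (hX : 0 ≤ X)
    (h : tr (σ * X) = 0) : X = 0 := by
  obtain ⟨a, rfl⟩ := CStarAlgebra.nonneg_iff_eq_star_mul_self.1 hσ.nonneg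
  obtain ⟨b, rfl⟩ := CStarAlgebra.nonneg_iff_eq_star_mul_self.1 hX
  have h1 : star (b * star a) * (b * star a) = a * (star b * b) * star a := by
    simp [mul_assoc]
  have h2 : b * star a = 0 := by
    apply eq_zero_of_tr_star_mul_self
    rw [h1, tr_mul_comm, ← mul_assoc, h]
  have h3 : b * (star a * a) = 0 := by rw [← mul_assoc, h2, zero_mul]
  have h4 : b = 0 := (hσ.isUnit.mul_left_eq_zero).1 h3
  simp [h4]

end Trace

/-! ### Functional calculus in finite dimension -/

section FunctionalCalculus

open scoped ComplexOrder
open Polynomial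

variable {H : Type*} [NormedAddCommGroup H] [InnerProductSpace ℂ H] [CompleteSpace H]
  [FiniteDimensional ℂ H]

lemma mem_spectrum_iff_hasEigenvalue {X : H →L[ℂ] H} {μ : ℝ} :
    μ ∈ spectrum ℝ X ↔ Module.End.HasEigenvalue (X : H →ₗ[ℂ] H) (μ : ℂ) := by
  rw [Module.End.hasEigenvalue_iff_mem_spectrum, ← spectrum.preimage_algebraMap ℂ,
    Set.mem_preimage]
  have := AlgEquiv.spectrum_eq (Module.End.toContinuousLinearMap (𝕜 := ℂ) H) (X : H →ₗ[ℂ] H)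
  rw [← this]
  rfl

lemma finite_spectrum (X : H →L[ℂ] H) : (spectrum ℝ X).Finite := by
  have : spectrum ℝ X = (fun μ : ℝ => (μ : ℂ)) ⁻¹' (spectrum ℂ (X : H →ₗ[ℂ] H)) := by
    ext μ
    rw [mem_spectrum_iff_hasEigenvalue, Module.End.hasEigenvalue_iff_mem_spectrum]; rfl
  rw [this]
  exact (Module.End.finite_spectrum _).preimage Complex.ofReal_injective.injOn

lemma continuousOn_spectrum (X : H →L[ℂ] H) (f : ℝ → ℝ) : ContinuousOn f (spectrum ℝ X) :=
  (finite_spectrum X).continuousOn f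

/-- In finite dimension the functional calculus is polynomial, and one polynomial serves for all
operators whose spectrum lies in a given finite set. -/
lemma exists_polynomial_cfc (f : ℝ → ℝ) (s : Finset ℝ) : ∃ q : ℝ[X], (∀ x ∈ s, q.eval x = f x) ∧
    ∀ X : H →L[ℂ] H, IsSelfAdjoint X → spectrum ℝ X ⊆ s → cfc f X = aeval X q := by
  classical
  have hq : ∀ x ∈ s, (Lagrange.interpolate s id f).eval x = f x := fun x hx =>
    Lagrange.eval_interpolate_at_node f (Set.injOn_id _) hx
  refine ⟨Lagrange.interpolate s id f, hq, fun X hX hs => ?_⟩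
  rw [← cfc_polynomial _ X hX]
  exact cfc_congr fun x hx => (hq x (hs hx)).symm

lemma exists_polynomial_cfc_single (f : ℝ → ℝ) {X : H →L[ℂ] H} (hX : IsSelfAdjoint X) :
    ∃ q : ℝ[X], cfc f X = aeval X q := by
  obtain ⟨q, -, hq⟩ := exists_polynomial_cfc (H := H) f (finite_spectrum X).toFinset
  exact ⟨q, hq X hX (by simp)⟩

lemma cfc_apply_of_eigenvector (f : ℝ → ℝ) {X : H →L[ℂ] H} (hX : IsSelfAdjoint X) {μ : ℝ} {x : H}
    (hx : X x = (μ : ℂ) • x) : cfc f X x = (f μ : ℂ) • x := by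
  obtain ⟨q, hq1, hq⟩ := exists_polynomial_cfc (H := H) f (insert μ (finite_spectrum X).toFinset)
  rw [hq X hX (by intro y hy; simp [hy]), ← hq1 μ (by simp)]
  clear hq hq1
  induction q using Polynomial.induction_on' with
  | add p q hp hq => simp [hp, hq, add_smul]
  | monomial n a =>
    have hpow : ∀ n : ℕ, (X ^ n) x = ((μ : ℂ) ^ n) • x := by
      intro n
      induction n with
      | zero => simp
      | succ n ih => rw [pow_succ', mul_apply_eq_comp, ih, map_smul, hx, smul_smul,
          pow_succ]
    rw [aeval_monomial, mul_apply_eq_comp, hpow, eval_monomial,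
      Algebra.algebraMap_eq_smul_one]
    push_cast
    rw [mul_smul]
    rfl

end FunctionalCalculus

/-! ### The Kadison-Schwarz inequality and the multiplicative domain -/

section CompletelyPositive

open scoped ComplexOrder

section

lemma exists_eq_star_mul_self {B : Type*} [NonUnitalCStarAlgebra B] [PartialOrder B]
    [StarOrderedRing B] {b : B} (hb : 0 ≤ b) : ∃ c, b = star c * c :=
  CStarAlgebra.nonneg_iff_eq_star_mul_self.1 hb

variable {A : Type*} [CStarAlgebra A] [PartialOrder A] [StarOrderedRing A] (φ : A →CP A)

/-- A unital completely positive map preserves adjoints and satisfies the Kadison-Schwarz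
inequality: both are read off from the positive matrix with rows `(φ(x*x), φ(x*))` and
`(φ(x), 1)`. -/
lemma map_star_and_schwarz (h1 : φ 1 = 1) (x : A) :
    φ (star x) = star (φ x) ∧ star (φ x) * φ x ≤ φ (star x * x) := by
  -- `star B * B` is the positive matrix with rows `(x*x, x*)` and `(x, 1)`; its image under `φ` is
  -- again of the form `star C * C`
  let B : CStarMatrix (Fin 2) (Fin 2) A := CStarMatrix.ofMatrix !![x, 1; 0, 0]
  have hM := φ.map_cstarMatrix_nonneg (star B * B) (star_mul_self_nonneg B)
  obtain ⟨C, hC⟩ := exists_eq_star_mul_self hM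
  have hent : ∀ i j, φ ((star B * B) i j) = star (C 0 i) * C 0 j + star (C 1 i) * C 1 j := by
    intro i j
    have := congrFun (congrFun hC i) j
    rw [CStarMatrix.map_apply] at this
    rw [this, CStarMatrix.mul_apply, Fin.sum_univ_two]
    rfl
  have hB : ∀ i j, (star B * B) i j = star (B 0 i) * B 0 j + star (B 1 i) * B 1 j := by
    intro i j
    rw [CStarMatrix.mul_apply, Fin.sum_univ_two]
    rfl
  have b00 : B 0 0 = x := rfl
  have b01 : B 0 1 = 1 := rfl
  have b10 : B 1 0 = 0 := rfl
  have b11 : B 1 1 = 0 := rfl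
  have e00 := hent 0 0
  have e01 := hent 0 1
  have e10 := hent 1 0
  have e11 := hent 1 1
  simp only [hB, b00, b01, b10, b11, star_zero, mul_zero, add_zero, mul_one, star_one, one_mul,
    h1] at e00 e01 e10 e11
  have hstar : φ (star x) = star (φ x) := by rw [e01, e10]; simp
  refine ⟨hstar, ?_⟩
  -- compress the positive matrix by the vector `(1, -φ(x))`
  have key : φ (star x * x) - star (φ x) * φ x =
      star (C 0 0 - C 0 1 * φ x) * (C 0 0 - C 0 1 * φ x) +
        star (C 1 0 - C 1 1 * φ x) * (C 1 0 - C 1 1 * φ x) := by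
    have : star (C 0 0 - C 0 1 * φ x) * (C 0 0 - C 0 1 * φ x) +
        star (C 1 0 - C 1 1 * φ x) * (C 1 0 - C 1 1 * φ x) =
        (star (C 0 0) * C 0 0 + star (C 1 0) * C 1 0)
        - (star (C 0 0) * C 0 1 + star (C 1 0) * C 1 1) * φ x
        - star (φ x) * (star (C 0 1) * C 0 0 + star (C 1 1) * C 1 0)
        + star (φ x) * (star (C 0 1) * C 0 1 + star (C 1 1) * C 1 1) * φ x := by
      simp only [star_sub, star_mul]
      noncomm_ring
    rw [this, ← e00, ← e01, ← e10, ← e11, hstar]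
    noncomm_ring
  rw [← sub_nonneg, key]
  exact add_nonneg (star_mul_self_nonneg _) (star_mul_self_nonneg _)

lemma cp_map_star (h1 : φ 1 = 1) (x : A) : φ (star x) = star (φ x) :=
  (map_star_and_schwarz φ h1 x).1

lemma schwarz (h1 : φ 1 = 1) (x : A) : star (φ x) * φ x ≤ φ (star x * x) :=
  (map_star_and_schwarz φ h1 x).2

lemma cp_isSelfAdjoint (h1 : φ 1 = 1) {x : A} (hx : IsSelfAdjoint x) : IsSelfAdjoint (φ x) := by
  rw [IsSelfAdjoint, ← cp_map_star φ h1, hx.star_eq]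

lemma cp_nonneg {x : A} (hx : 0 ≤ x) : 0 ≤ φ x := by
  have := OrderHomClass.mono φ hx
  rwa [map_zero] at this

/-- A unital completely positive map is a contraction. -/
lemma cp_norm_le (h1 : φ 1 = 1) (x : A) : ‖φ x‖ ≤ ‖x‖ := by
  nontriviality A
  have h2 : φ (star x * x) ≤ algebraMap ℝ A (‖x‖ ^ 2) := by
    have h3 : star x * x ≤ algebraMap ℝ A (‖x‖ ^ 2) := CStarAlgebra.star_mul_le_algebraMap_norm_sq
    have h4 := OrderHomClass.mono φ h3
    have h5 : φ (algebraMap ℝ A (‖x‖ ^ 2)) = algebraMap ℝ A (‖x‖ ^ 2) := by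
      have h6 : algebraMap ℝ A (‖x‖ ^ 2) = ((‖x‖ ^ 2 : ℝ) : ℂ) • (1 : A) := by
        rw [Algebra.algebraMap_eq_smul_one]; rfl
      rw [h6, map_smul, h1]
    rwa [h5] at h4
  have h3 := CStarAlgebra.norm_le_norm_of_nonneg_of_le (star_mul_self_nonneg _)
    ((schwarz φ h1 x).trans h2)
  rw [CStarRing.norm_star_mul_self, norm_algebraMap', Real.norm_of_nonneg (by positivity)] at h3
  nlinarith [norm_nonneg (φ x), norm_nonneg x]

end

variable {H : Type*} [NormedAddCommGroup H] [InnerProductSpace ℂ H] [CompleteSpace H]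
  (φ : (H →L[ℂ] H) →CP (H →L[ℂ] H))

/-- The multiplicative domain: equality in the Kadison-Schwarz inequality at `x` makes `φ`
multiplicative against `x`. The defect `φ(y*z) - φ(y)*φ(z)` is a positive sesquilinear form
with values in the operators, so a vector of zero length is orthogonal to everything. -/
lemma map_star_mul_of_schwarz_eq (h1 : φ 1 = 1) {x : H →L[ℂ] H}
    (hx : φ (star x * x) = star (φ x) * φ x) (y : H →L[ℂ] H) :
    φ (star x * y) = star (φ x) * φ y := by
  rw [← sub_eq_zero]
  set D := φ (star x * y) - star (φ x) * φ y with hD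
  have hD' : star D = φ (star y * x) - star (φ y) * φ x := by
    rw [hD, star_sub, ← cp_map_star φ h1, star_mul, star_star, star_mul, star_star]
  have hz : ∀ z : ℂ, 0 ≤ star z • D + z • star D + (φ (star y * y) - star (φ y) * φ y) := by
    intro z
    have h := sub_nonneg.2 (schwarz φ h1 (z • x + y))
    have e : φ (star (z • x + y) * (z • x + y)) - star (φ (z • x + y)) * φ (z • x + y) =
        star z • D + z • star D + (φ (star y * y) - star (φ y) * φ y) := by
      rw [hD', hD]
      simp only [star_add, star_smul, add_mul, mul_add, smul_mul_assoc, mul_smul_comm, map_add,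
        map_smul, smul_sub, smul_add, hx]
      abel
    rwa [e] at h
  have hv : ∀ v, ⟪v, D v⟫_ℂ = 0 := by
    intro v
    set c := ⟪v, D v⟫_ℂ with hc
    set r := (⟪v, (φ (star y * y) - star (φ y) * φ y) v⟫_ℂ).re
    have hc' : ⟪v, star D v⟫_ℂ = star c := by
      rw [ContinuousLinearMap.star_eq_adjoint, ContinuousLinearMap.adjoint_inner_right,
        RCLike.star_def, inner_conj_symm]
    -- the diagonal entry at `x` vanishes, so at `z = -n * c` the form is affine in `n`
    have hn : ∀ n : ℕ, 2 * n * Complex.normSq c ≤ r := by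
      intro n
      have h2 := nonneg_iff_inner.1 (hz (-(n : ℂ) * c)) v
      have h3 := (Complex.nonneg_iff.1 h2).1
      simp only [add_apply, smul_apply, inner_add_right,
        inner_smul_right, hc', ← hc, Complex.add_re] at h3
      simp only [RCLike.star_def, Complex.mul_re, Complex.neg_re, Complex.natCast_re,
        Complex.conj_re, Complex.conj_im, map_mul, map_neg, Complex.conj_natCast, Complex.mul_im,
        Complex.neg_im, Complex.natCast_im] at h3
      rw [Complex.normSq_apply]
      change _ ≤ (⟪v, (φ (star y * y) - star (φ y) * φ y) v⟫_ℂ).re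
      linarith
    by_contra hne
    have hpos : 0 < Complex.normSq c := Complex.normSq_pos.2 hne
    obtain ⟨n, hn'⟩ := exists_nat_gt (r / (2 * Complex.normSq c))
    rw [div_lt_iff₀ (by positivity)] at hn'
    linarith [hn n]
  have := (inner_map_self_eq_zero (D : H →ₗ[ℂ] H)).1 fun v => by
    rw [← inner_conj_symm, ContinuousLinearMap.coe_coe, hv v, map_zero]
  ext v
  exact congrArg (fun f : H →ₗ[ℂ] H => f v) this

end CompletelyPositive

/-! ### The decoherence-free algebra -/

section DecoherenceFree

open scoped ComplexOrder
open Filter Polynomial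

variable {H : Type*} [NormedAddCommGroup H] [InnerProductSpace ℂ H] [CompleteSpace H]
  (P : QuantumMarkovSemigroup H)

/-- Membership in the decoherence-free algebra is equality in the Kadison-Schwarz inequality, for
`X` and for `star X`. -/
lemma mem_dfAlgebra_iff {X : H →L[ℂ] H} : X ∈ dfAlgebra P ↔ ∀ t,
    P.map t (star X * X) = star (P.map t X) * P.map t X ∧
      P.map t (X * star X) = P.map t X * star (P.map t X) := by
  refine ⟨fun h t => h t X, fun h t Y => ⟨?_, ?_⟩⟩
  · exact map_star_mul_of_schwarz_eq _ (P.map_one t) (h t).1 Y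
  · have h1 := map_star_mul_of_schwarz_eq (P.map t) (P.map_one t) (x := star X)
      (by rw [star_star, cp_map_star _ (P.map_one t), star_star]; exact (h t).2) (star Y)
    have h2 := congrArg star h1
    rwa [← cp_map_star _ (P.map_one t), star_mul, star_mul, ← cp_map_star _ (P.map_one t),
      ← cp_map_star _ (P.map_one t), star_star, star_star, star_star] at h2

variable {P}

lemma star_mem_dfAlgebra {X : H →L[ℂ] H} (hX : X ∈ dfAlgebra P) : star X ∈ dfAlgebra P := by
  rw [mem_dfAlgebra_iff] at hX ⊢
  intro t
  simp only [star_star, cp_map_star _ (P.map_one t)]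
  exact (hX t).symm

lemma map_mul_of_mem_left {X : H →L[ℂ] H} (hX : X ∈ dfAlgebra P) (t : ℝ≥0) (Y : H →L[ℂ] H) :
    P.map t (X * Y) = P.map t X * P.map t Y := by
  have := (star_mem_dfAlgebra hX t Y).1
  rwa [cp_map_star _ (P.map_one t), star_star, star_star] at this

lemma map_mul_of_mem_right {X : H →L[ℂ] H} (hX : X ∈ dfAlgebra P) (t : ℝ≥0) (Y : H →L[ℂ] H) :
    P.map t (Y * X) = P.map t Y * P.map t X := by
  have := (star_mem_dfAlgebra hX t Y).2
  rwa [cp_map_star _ (P.map_one t), star_star, star_star] at this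

variable (P) in
/-- The decoherence-free algebra as a star subalgebra. -/
def dfStarSubalgebra : StarSubalgebra ℂ (H →L[ℂ] H) where
  carrier := dfAlgebra P
  mul_mem' {X Y} hX hY := fun t Z => by
    constructor
    · rw [star_mul, mul_assoc, map_mul_of_mem_left (star_mem_dfAlgebra hY),
        map_mul_of_mem_left (star_mem_dfAlgebra hX), map_mul_of_mem_left hX, star_mul,
        cp_map_star _ (P.map_one t), cp_map_star _ (P.map_one t), mul_assoc]
    · rw [star_mul, ← mul_assoc, map_mul_of_mem_right (star_mem_dfAlgebra hX),
        map_mul_of_mem_right (star_mem_dfAlgebra hY), map_mul_of_mem_left hX, star_mul,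
        cp_map_star _ (P.map_one t), cp_map_star _ (P.map_one t), mul_assoc]
  add_mem' {X Y} hX hY := fun t Z => by
    constructor
    · simp only [star_add, add_mul, map_add, (hX t Z).1, (hY t Z).1]
    · simp only [star_add, mul_add, map_add, (hX t Z).2, (hY t Z).2]
  algebraMap_mem' c := fun t Z => by
    simp only [Algebra.algebraMap_eq_smul_one, star_smul, star_one, smul_mul_assoc, one_mul,
      map_smul, P.map_one, mul_smul_comm, mul_one, and_self]
  star_mem' := star_mem_dfAlgebra

lemma mem_dfStarSubalgebra {X : H →L[ℂ] H} : X ∈ dfStarSubalgebra P ↔ X ∈ dfAlgebra P := Iff.rfl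

lemma map_mem_dfAlgebra {X : H →L[ℂ] H} (hX : X ∈ dfAlgebra P) (t : ℝ≥0) :
    P.map t X ∈ dfAlgebra P := by
  rw [mem_dfAlgebra_iff]
  intro s
  constructor
  · rw [← cp_map_star _ (P.map_one t), ← map_mul_of_mem_right hX, ← P.map_add,
      map_mul_of_mem_right hX, cp_map_star _ (P.map_one (s + t)), P.map_add]
  · rw [← cp_map_star _ (P.map_one t), ← map_mul_of_mem_left hX, ← P.map_add,
      map_mul_of_mem_left hX, cp_map_star _ (P.map_one (s + t)), P.map_add]

lemma aeval_mem_dfAlgebra {X : H →L[ℂ] H} (hX : X ∈ dfAlgebra P) (q : ℝ[X]) :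
    aeval X q ∈ dfAlgebra P := by
  rw [← mem_dfStarSubalgebra] at hX ⊢
  induction q using Polynomial.induction_on' with
  | add p q hp hq => rw [map_add]; exact add_mem hp hq
  | monomial n a =>
    rw [aeval_monomial, Algebra.algebraMap_eq_smul_one, smul_mul_assoc, one_mul]
    exact (dfStarSubalgebra P).smul_mem (pow_mem hX n) (a : ℂ)

lemma map_aeval_of_mem {X : H →L[ℂ] H} (hX : X ∈ dfAlgebra P) (t : ℝ≥0) (q : ℝ[X]) :
    P.map t (aeval X q) = aeval (P.map t X) q := by
  induction q using Polynomial.induction_on' with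
  | add p q hp hq => simp [hp, hq]
  | monomial n a =>
    have hpow : P.map t (X ^ n) = P.map t X ^ n := by
      induction n with
      | zero => simp [P.map_one]
      | succ n ih => rw [pow_succ, map_mul_of_mem_right hX, ih, pow_succ]
    simp only [aeval_monomial, Algebra.algebraMap_eq_smul_one, smul_mul_assoc, one_mul, ← hpow]
    exact map_smul (P.map t) (a : ℂ) _

variable [FiniteDimensional ℂ H]

lemma cfc_mem_dfAlgebra {X : H →L[ℂ] H} (hX : X ∈ dfAlgebra P) (hs : IsSelfAdjoint X)
    (f : ℝ → ℝ) : cfc f X ∈ dfAlgebra P := by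
  obtain ⟨q, hq⟩ := exists_polynomial_cfc_single f hs
  rw [hq]
  exact aeval_mem_dfAlgebra hX q

lemma map_cfc_of_mem {X : H →L[ℂ] H} (hX : X ∈ dfAlgebra P) (hs : IsSelfAdjoint X)
    (f : ℝ → ℝ) (t : ℝ≥0) : P.map t (cfc f X) = cfc f (P.map t X) := by
  obtain ⟨q, -, hq⟩ := exists_polynomial_cfc (H := H) f
    ((finite_spectrum X).toFinset ∪ (finite_spectrum (P.map t X)).toFinset)
  rw [hq X hs (by simp), hq _ (cp_isSelfAdjoint _ (P.map_one t) hs) (by simp),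
    map_aeval_of_mem hX]

end DecoherenceFree

/-! ### Limits of completely positive maps -/

section Limits

open scoped ComplexOrder
open Filter Polynomial

lemma nonneg_of_tendsto {B ι : Type*} [NonUnitalCStarAlgebra B] [PartialOrder B]
    [StarOrderedRing B] {l : Filter ι} [l.NeBot] {f : ι → B} {b : B} (h : Tendsto f l (𝓝 b))
    (hf : ∀ i, 0 ≤ f i) : 0 ≤ b :=
  CStarAlgebra.isClosed_nonneg.mem_of_tendsto h (Eventually.of_forall hf)

variable {H : Type*} [NormedAddCommGroup H] [InnerProductSpace ℂ H] [CompleteSpace H]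
  [FiniteDimensional ℂ H]

lemma continuous_cp (φ : (H →L[ℂ] H) →CP (H →L[ℂ] H)) : Continuous φ :=
  LinearMap.continuous_of_finiteDimensional φ.toLinearMap

/-- In finite dimension, unital completely positive maps converge along any ultrafilter, and
the limit is completely positive. -/
lemma exists_cp_limit {ι : Type*} (𝒰 : Ultrafilter ι) (F : ι → (H →L[ℂ] H) →CP (H →L[ℂ] H))
    (h1 : ∀ i, F i 1 = 1) : ∃ G : (H →L[ℂ] H) →CP (H →L[ℂ] H),
    ∀ X, Tendsto (fun i => F i X) 𝒰 (𝓝 (G X)) := by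
  have : ProperSpace (H →L[ℂ] H) := FiniteDimensional.proper ℂ _
  have hlim : ∀ X, ∃ Z, Tendsto (fun i => F i X) 𝒰 (𝓝 Z) := by
    intro X
    obtain ⟨Z, -, hZ⟩ := isCompact_iff_ultrafilter_le_nhds.1
      (isCompact_closedBall (0 : H →L[ℂ] H) ‖X‖) (𝒰.map fun i => F i X) (by
        rw [le_principal_iff]
        exact Eventually.of_forall (f := (𝒰 : Filter ι)) fun i => by
          simpa using cp_norm_le (F i) (h1 i) X)
    exact ⟨Z, hZ⟩
  choose G hG using hlim
  refine ⟨{ toFun := G, map_add' := fun X Y => ?_, map_smul' := fun c X => ?_,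
            map_cstarMatrix_nonneg' := fun k M hM => ?_ }, hG⟩
  · refine tendsto_nhds_unique (hG (X + Y)) ?_
    simpa only [map_add] using (hG X).add (hG Y)
  · refine tendsto_nhds_unique (hG (c • X)) ?_
    simpa only [map_smul, RingHom.id_apply] using (hG X).const_smul c
  · refine nonneg_of_tendsto (l := (𝒰 : Filter ι)) (f := fun i => M.map (F i)) ?_ fun i =>
      (F i).map_cstarMatrix_nonneg M hM
    refine tendsto_pi_nhds.2 fun a => tendsto_pi_nhds.2 fun b => ?_
    exact hG (M a b)

end Limits

/-! ### Existence and uniqueness of the conditional expectation -/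

section Expectation

open scoped ComplexOrder
open Filter

variable {H : Type*} [NormedAddCommGroup H] [InnerProductSpace ℂ H] [CompleteSpace H]
  [FiniteDimensional ℂ H]

lemma cp_ext {φ ψ : (H →L[ℂ] H) →CP (H →L[ℂ] H)} (h : ∀ X, φ X = ψ X) : φ = ψ :=
  DFunLike.ext _ _ h

/-- The square `Tr[σ X* X]` of the GNS norm of `X` for the state `σ`. It is real for positive `σ`;
taking the real part makes it a real number in all cases. -/
noncomputable def gnsSq (σ X : H →L[ℂ] H) : ℝ := (tr (σ * (star X * X))).re

lemma gnsSq_nonneg {σ : H →L[ℂ] H} (hσ : 0 ≤ σ) (X : H →L[ℂ] H) : 0 ≤ gnsSq σ X :=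
  tr_mul_re_nonneg hσ (star_mul_self_nonneg X)

@[simp] lemma gnsSq_zero (σ : H →L[ℂ] H) : gnsSq σ 0 = 0 := by simp [gnsSq]

lemma eq_zero_of_gnsSq {σ X : H →L[ℂ] H} (hσ : IsStrictlyPositive σ) (h : gnsSq σ X = 0) :
    X = 0 := by
  have h1 := tr_mul_nonneg hσ.nonneg (star_mul_self_nonneg X)
  have h2 : tr (σ * (star X * X)) = 0 := Complex.ext h (Complex.nonneg_iff.1 h1).2.symm
  have h3 := eq_zero_of_tr_mul_eq_zero hσ (star_mul_self_nonneg X) h2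
  exact CStarRing.star_mul_self_eq_zero_iff X |>.1 h3

lemma continuous_gnsSq (σ : H →L[ℂ] H) : Continuous (gnsSq σ) :=
  Complex.continuous_re.comp (continuous_tr.comp (by fun_prop))

variable {P : QuantumMarkovSemigroup H} {σ : H →L[ℂ] H}

lemma gnsSq_map_le (hσ : IsInvariantState P σ) (t : ℝ≥0) (X : H →L[ℂ] H) :
    gnsSq σ (P.map t X) ≤ gnsSq σ X := by
  have h1 := tr_mul_re_le hσ.1.1 (schwarz (P.map t) (P.map_one t) X)
  rwa [hσ.2] at h1

lemma gnsSq_antitone (hσ : IsInvariantState P σ) (X : H →L[ℂ] H) :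
    Antitone fun t => gnsSq σ (P.map t X) := by
  intro s t hst
  change gnsSq σ (P.map t X) ≤ gnsSq σ (P.map s X)
  rw [← tsub_add_cancel_of_le hst, P.map_add]
  exact gnsSq_map_le hσ _ _

lemma schwarz_eq_of_gnsSq_eq (hσ : IsInvariantState P σ) (hf : IsStrictlyPositive σ) {t : ℝ≥0}
    {X : H →L[ℂ] H} (h : gnsSq σ (P.map t X) = gnsSq σ X) :
    P.map t (star X * X) = star (P.map t X) * P.map t X := by
  have h1 := sub_nonneg.2 (schwarz (P.map t) (P.map_one t) X)
  rw [← sub_eq_zero]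
  refine eq_zero_of_tr_mul_eq_zero hf h1 ?_
  refine Complex.ext ?_ (Complex.nonneg_iff.1 (tr_mul_nonneg hf.nonneg h1)).2.symm
  rw [mul_sub, tr_sub, hσ.2, Complex.sub_re]
  exact sub_eq_zero.2 h.symm

/-- Existence of the conditional expectation. Let `Q` be the limit of `P_t` along an ultrafilter
`𝒰` at infinity, `Q_s` the limit of `P_{t-s}` in `t`, and `R` the limit of `Q_s` in `s`, both
along `𝒰`. As `P_s Q_s = Q`, one has `Q R = Q`; as `P_t` contracts the GNS norm, `Q` and `R` kill
exactly the observables that vanish in the long time. So `R (R X - X) = 0`. If `R X = X`, then every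
`P_t` preserves the GNS norm of `X`, which is equality in the Kadison-Schwarz inequality. -/
theorem exists_dfExpectation (hσ : IsInvariantState P σ) (hf : IsStrictlyPositive σ) :
    ∃ E : (H →L[ℂ] H) →CP (H →L[ℂ] H), IsDFExpectation P σ E := by
  let 𝒰 : Ultrafilter ℝ≥0 := Ultrafilter.of atTop
  have h𝒰 : (𝒰 : Filter ℝ≥0) ≤ atTop := Ultrafilter.of_le _
  obtain ⟨Q, hQ⟩ := exists_cp_limit 𝒰 P.map P.map_one
  have hQs' : ∀ s : ℝ≥0, ∃ G : (H →L[ℂ] H) →CP (H →L[ℂ] H),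
      ∀ X, Tendsto (fun t => P.map (t - s) X) 𝒰 (𝓝 (G X)) :=
    fun s => exists_cp_limit 𝒰 (fun t => P.map (t - s)) fun t => P.map_one _
  choose Qs hQs using hQs'
  have hQs1 : ∀ s, Qs s 1 = 1 := fun s => tendsto_nhds_unique (hQs s 1) (by simp [P.map_one])
  obtain ⟨R, hR⟩ := exists_cp_limit 𝒰 Qs hQs1
  have hR1 : R 1 = 1 := tendsto_nhds_unique (hR 1) (by simp [hQs1])
  have hPQ : ∀ s X, P.map s (Qs s X) = Q X := by
    intro s X
    refine tendsto_nhds_unique (((continuous_cp (P.map s)).tendsto _).comp (hQs s X)) ?_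
    refine (hQ X).congr' (h𝒰 ?_)
    filter_upwards [eventually_ge_atTop s] with t ht
    rw [Function.comp_apply, ← P.map_add, add_tsub_cancel_of_le ht]
  have hQR : ∀ X, Q (R X) = Q X := by
    intro X
    have h1 : Tendsto (fun s => P.map s (Qs s X - R X)) 𝒰 (𝓝 0) := by
      refine squeeze_zero_norm (fun s => cp_norm_le (P.map s) (P.map_one s) _) ?_
      have := ((hR X).sub_const (R X)).norm
      simpa using this
    have h2 := h1.add (hQ (R X))
    simp only [map_sub, hPQ, sub_add_cancel, zero_add] at h2
    exact (tendsto_nhds_unique h2 tendsto_const_nhds)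
  have hgQ : ∀ X, Tendsto (fun t => gnsSq σ (P.map t X)) atTop (𝓝 (gnsSq σ (Q X))) := by
    intro X
    have h1 := tendsto_atTop_ciInf (gnsSq_antitone hσ X)
      ⟨0, by rintro _ ⟨t, rfl⟩; exact gnsSq_nonneg hσ.1.1 _⟩
    have h2 := ((continuous_gnsSq σ).tendsto _).comp (hQ X)
    rwa [tendsto_nhds_unique (h1.mono_left h𝒰) h2] at h1
  have hgR : ∀ X, gnsSq σ (R X) = gnsSq σ (Q X) := by
    intro X
    have h1 : ∀ s, gnsSq σ (Qs s X) = gnsSq σ (Q X) := by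
      intro s
      have h2 : Tendsto (fun t : ℝ≥0 => t - s) atTop atTop :=
        tendsto_atTop.2 fun b => (eventually_ge_atTop (b + s)).mono fun t ht =>
          le_tsub_of_add_le_right ht
      exact tendsto_nhds_unique (((continuous_gnsSq σ).tendsto _).comp (hQs s X))
        (((hgQ X).comp h2).mono_left h𝒰)
    have h3 := ((continuous_gnsSq σ).tendsto _).comp (hR X)
    refine tendsto_nhds_unique h3 ?_
    simp only [Function.comp_def, h1, tendsto_const_nhds]
  have hker : ∀ X, R X = 0 ↔ Q X = 0 := fun X =>
    ⟨fun h => eq_zero_of_gnsSq hf (by rw [← hgR, h, gnsSq_zero]),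
     fun h => eq_zero_of_gnsSq hf (by rw [hgR, h, gnsSq_zero])⟩
  have hRR : ∀ X, R (R X) = R X := by
    intro X
    rw [← sub_eq_zero, ← map_sub, hker, map_sub, hQR, sub_self]
  have hlimR : ∀ X, Tendsto (fun t => gnsSq σ (P.map t X)) atTop (𝓝 (gnsSq σ (R X))) := by
    intro X
    rw [hgR]
    exact hgQ X
  have hfix : ∀ X, R X = X → ∀ t, gnsSq σ (P.map t X) = gnsSq σ X := by
    intro X hX t
    refine le_antisymm (gnsSq_map_le hσ t X) ?_
    have := (gnsSq_antitone hσ X).le_of_tendsto (hlimR X) t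
    rwa [hX] at this
  have hmem : ∀ X, R X = X → X ∈ dfAlgebra P := by
    intro X hX
    rw [mem_dfAlgebra_iff]
    intro t
    refine ⟨schwarz_eq_of_gnsSq_eq hσ hf (hfix X hX t), ?_⟩
    have hX' : R (star X) = star X := by rw [cp_map_star R hR1, hX]
    have := schwarz_eq_of_gnsSq_eq hσ hf (hfix _ hX' t)
    rwa [cp_map_star _ (P.map_one t), star_star, star_star] at this
  refine ⟨R, hRR, fun X => ?_, ?_, fun X => ?_⟩
  · have hc : Continuous fun Z => tr (σ * Z) := continuous_tr.comp (by fun_prop)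
    have h1 : ∀ s, tr (σ * Qs s X) = tr (σ * X) := fun s =>
      tendsto_nhds_unique ((hc.tendsto _).comp (hQs s X))
        (by simp only [Function.comp_def, hσ.2, tendsto_const_nhds])
    exact tendsto_nhds_unique ((hc.tendsto _).comp (hR X))
      (by simp only [Function.comp_def, h1, tendsto_const_nhds])
  · ext X
    refine ⟨?_, fun hX => ⟨X, ?_⟩⟩
    · rintro ⟨Y, rfl⟩
      exact hmem _ (hRR Y)
    · have hZ : X - R X ∈ dfStarSubalgebra P := sub_mem hX (hmem _ (hRR X))
      have hZt : ∀ t, gnsSq σ (P.map t (X - R X)) = gnsSq σ (X - R X) := by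
        intro t
        rw [gnsSq, ← ((mem_dfAlgebra_iff P).1 hZ t).1, hσ.2, gnsSq]
      have h1 := hlimR (X - R X)
      simp only [hZt, map_sub R, hRR, sub_self, gnsSq_zero] at h1
      exact (sub_eq_zero.1 (eq_zero_of_gnsSq hf
        (tendsto_nhds_unique tendsto_const_nhds h1))).symm
  · rw [hker]
    refine ⟨fun h => ?_, fun h => tendsto_nhds_unique (hQ X) (h.mono_left h𝒰)⟩
    rw [tendsto_iff_ultrafilter]
    intro 𝒱 h𝒱
    obtain ⟨G, hG⟩ := exists_cp_limit 𝒱 P.map P.map_one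
    have h1 := tendsto_nhds_unique (((continuous_gnsSq σ).tendsto _).comp (hG X))
      ((hgQ X).mono_left h𝒱)
    rw [h, gnsSq_zero] at h1
    rw [← eq_zero_of_gnsSq hf h1]
    exact hG X

theorem existsUnique_dfExpectation (hσ : IsInvariantState P σ) (hf : IsStrictlyPositive σ) :
    ∃! E : (H →L[ℂ] H) →CP (H →L[ℂ] H), IsDFExpectation P σ E := by
  obtain ⟨E, hE⟩ := exists_dfExpectation hσ hf
  refine ⟨E, hE, fun F hF => cp_ext fun X => ?_⟩
  have h1 : E (X - E X) = 0 := by rw [map_sub, hE.idempotent, sub_self]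
  have h2 : F (X - E X) = 0 := (hF.ker_iff _).2 ((hE.ker_iff _).1 h1)
  have h3 : E X ∈ Set.range F := by
    rw [hF.range_eq, ← hE.range_eq]
    exact ⟨X, rfl⟩
  obtain ⟨Y, hY⟩ := h3
  rw [map_sub, sub_eq_zero, ← hY, hF.idempotent] at h2
  rw [h2, hY]

end Expectation

/-! ### The conditional expectation and the reference state -/

section ExpectationProperties

open scoped ComplexOrder
open Filter

variable {H : Type*} [NormedAddCommGroup H] [InnerProductSpace ℂ H] [CompleteSpace H]
  {P : QuantumMarkovSemigroup H} {σ : H →L[ℂ] H} {E : (H →L[ℂ] H) →CP (H →L[ℂ] H)}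

lemma IsDFExpectation.mem (hE : IsDFExpectation P σ E) (X : H →L[ℂ] H) : E X ∈ dfAlgebra P :=
  hE.range_eq ▸ ⟨X, rfl⟩

lemma IsDFExpectation.apply_of_mem (hE : IsDFExpectation P σ E) {X : H →L[ℂ] H}
    (hX : X ∈ dfAlgebra P) : E X = X := by
  rw [← hE.range_eq] at hX
  obtain ⟨Y, rfl⟩ := hX
  exact hE.idempotent Y

lemma IsDFExpectation.map_one (hE : IsDFExpectation P σ E) : E 1 = 1 :=
  hE.apply_of_mem (one_mem (dfStarSubalgebra P))

lemma IsDFExpectation.map_star (hE : IsDFExpectation P σ E) (X : H →L[ℂ] H) :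
    E (star X) = star (E X) := cp_map_star E hE.map_one X

lemma IsDFExpectation.map_mul_left (hE : IsDFExpectation P σ E) {a : H →L[ℂ] H}
    (ha : a ∈ dfAlgebra P) (X : H →L[ℂ] H) : E (a * X) = a * E X := by
  have ha' := star_mem_dfAlgebra ha
  have h1 : a * star a ∈ dfAlgebra P := (dfStarSubalgebra P).mul_mem ha ha'
  have := map_star_mul_of_schwarz_eq E hE.map_one (x := star a)
    (by rw [hE.apply_of_mem ha', star_star, hE.apply_of_mem h1]) X
  rwa [hE.apply_of_mem ha', star_star] at this

lemma IsDFExpectation.map_mul_right (hE : IsDFExpectation P σ E) {a : H →L[ℂ] H}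
    (ha : a ∈ dfAlgebra P) (X : H →L[ℂ] H) : E (X * a) = E X * a := by
  have := congrArg star (hE.map_mul_left (star_mem_dfAlgebra ha) (star X))
  rwa [← star_mul, hE.map_star, star_star, hE.map_star, star_mul, star_star, star_star] at this

lemma IsDFExpectation.map_apply_eq_zero (hE : IsDFExpectation P σ E) {X : H →L[ℂ] H}
    (hX : E X = 0) (t : ℝ≥0) : E (P.map t X) = 0 := by
  rw [hE.ker_iff] at hX ⊢
  simp only [← P.map_add]
  exact hX.comp (tendsto_atTop_mono (fun s => le_self_add) tendsto_id)

lemma IsDFExpectation.comm (hE : IsDFExpectation P σ E) (X : H →L[ℂ] H) (t : ℝ≥0) :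
    E (P.map t X) = P.map t (E X) := by
  have h1 : E (X - E X) = 0 := by rw [map_sub, hE.idempotent, sub_self]
  have h2 := hE.map_apply_eq_zero h1 t
  rwa [_root_.map_sub (P.map t), _root_.map_sub E, sub_eq_zero,
    hE.apply_of_mem (map_mem_dfAlgebra (hE.mem X) t)] at h2

variable [FiniteDimensional ℂ H]

/-- A semigroup with a faithful invariant state acts on its decoherence-free algebra by injective
maps. -/
lemma eq_zero_of_map_eq_zero (hσ : IsInvariantState P σ) (hf : IsStrictlyPositive σ)
    {X : H →L[ℂ] H} (hX : X ∈ dfAlgebra P) {t : ℝ≥0} (h : P.map t X = 0) : X = 0 := by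
  have h1 := ((mem_dfAlgebra_iff P).1 hX t).1
  rw [h, mul_zero] at h1
  have h2 := hσ.2 t (star X * X)
  rw [h1, mul_zero, tr_zero] at h2
  exact (CStarRing.star_mul_self_eq_zero_iff X).1
    (eq_zero_of_tr_mul_eq_zero hf (star_mul_self_nonneg X) h2.symm)

/-- In finite dimension, injectivity makes the semigroup act on the decoherence-free algebra by
bijections. -/
lemma exists_map_eq_of_mem (hσ : IsInvariantState P σ) (hf : IsStrictlyPositive σ)
    {X : H →L[ℂ] H} (hX : X ∈ dfAlgebra P) (t : ℝ≥0) : ∃ Y ∈ dfAlgebra P, P.map t Y = X := by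
  let N : Submodule ℂ (H →L[ℂ] H) := Subalgebra.toSubmodule (dfStarSubalgebra P).toSubalgebra
  let f : N →ₗ[ℂ] N := (P.map t).toLinearMap.restrict fun Y hY => map_mem_dfAlgebra hY t
  have hinj : Function.Injective f := by
    rw [← LinearMap.ker_eq_bot, LinearMap.ker_eq_bot']
    intro Y hY
    exact Subtype.ext (eq_zero_of_map_eq_zero hσ hf Y.2 (congrArg Subtype.val hY))
  obtain ⟨Y, hY⟩ := LinearMap.injective_iff_surjective.1 hinj ⟨X, hX⟩
  exact ⟨Y, Y.2, congrArg Subtype.val hY⟩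

/-- The trace of a projection is an integer, so it is constant along a continuous path of
projections; as the decoherence-free algebra is spanned by its projections, the semigroup
preserves the trace there. -/
lemma tr_map_of_mem {X : H →L[ℂ] H} (hX : X ∈ dfAlgebra P) (t : ℝ≥0) :
    tr (P.map t X) = tr X := by
  have hproj : ∀ p ∈ dfAlgebra P, p * p = p → tr (P.map t p) = tr p := by
    intro p hp hpp
    have hnat : ∀ s, ∃ n : ℕ, tr (P.map s p) = n := by
      intro s
      have h1 : IsIdempotentElem ((P.map s p : H →L[ℂ] H) : H →ₗ[ℂ] H) := by
        rw [IsIdempotentElem, ← ContinuousLinearMap.toLinearMap_mul, ← map_mul_of_mem_left hp, hpp]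
      exact ⟨_, (LinearMap.IsIdempotentElem.isProj_range _ h1).trace⟩
    choose n hn using hnat
    have hc : Continuous n := by
      have h1 : Continuous fun s => (n s : ℝ) := by
        have h2 : ∀ s, (n s : ℝ) = (tr (P.map s p)).re := fun s => by rw [hn, Complex.natCast_re]
        simp only [h2]
        exact Complex.continuous_re.comp (continuous_tr.comp (P.continuous p))
      exact Nat.isClosedEmbedding_coe_real.isInducing.continuous_iff.2 h1
    have h2 : n t = n 0 := PreconnectedSpace.constant inferInstance hc
    have h3 := hn 0
    rw [P.map_zero] at h3
    rw [hn, h2, h3]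
  have hsa : ∀ a ∈ dfAlgebra P, IsSelfAdjoint a → tr (P.map t a) = tr a := by
    intro a ha hs
    let f : ℝ → ℝ → ℝ := fun μ x => if x = μ then 1 else 0
    have hsum : a = ∑ μ ∈ (finite_spectrum a).toFinset, (μ : ℂ) • cfc (f μ) a := by
      have h1 : a = cfc (fun x => ∑ μ ∈ (finite_spectrum a).toFinset, μ * f μ x) a := by
        conv_lhs => rw [← cfc_id' ℝ a]
        refine cfc_congr fun x hx => ?_
        simp only [f, mul_ite, mul_one, mul_zero]
        rw [Finset.sum_ite_eq]
        simp [hx]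
      conv_lhs => rw [h1]
      have h2 := cfc_sum (fun μ x => μ * f μ x) a (finite_spectrum a).toFinset
        fun μ _ => continuousOn_spectrum _ _
      rw [Finset.sum_fn] at h2
      rw [h2]
      refine Finset.sum_congr rfl fun μ _ => ?_
      rw [cfc_const_mul μ (f μ) a (continuousOn_spectrum _ _)]
      rfl
    have hp : ∀ μ, tr (P.map t (cfc (f μ) a)) = tr (cfc (f μ) a) := fun μ => by
      refine hproj _ (cfc_mem_dfAlgebra ha hs _) ?_
      rw [← cfc_mul _ _ _ (continuousOn_spectrum _ _) (continuousOn_spectrum _ _)]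
      exact cfc_congr fun x _ => by simp [f]
    rw [hsum, map_sum, tr_sum, tr_sum]
    exact Finset.sum_congr rfl fun μ _ => by rw [map_smul, tr_smul, tr_smul, hp]
  have hre : (realPart X : H →L[ℂ] H) ∈ dfStarSubalgebra P := by
    rw [realPart_apply_coe]
    exact (dfStarSubalgebra P).smul_mem (add_mem hX (star_mem_dfAlgebra hX)) ((2⁻¹ : ℝ) : ℂ)
  have him : (imaginaryPart X : H →L[ℂ] H) ∈ dfStarSubalgebra P := by
    rw [imaginaryPart_apply_coe]
    exact (dfStarSubalgebra P).smul_mem ((dfStarSubalgebra P).smul_mem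
      (sub_mem hX (star_mem_dfAlgebra hX)) ((2⁻¹ : ℝ) : ℂ)) _
  rw [← realPart_add_I_smul_imaginaryPart X]
  simp only [map_add, map_smul, tr_add, tr_smul, hsa _ hre (realPart X).2,
    hsa _ him (imaginaryPart X).2]

lemma isUnit_of_injective {A : H →L[ℂ] H} (h : ∀ x, A x = 0 → x = 0) : IsUnit A := by
  have hinj : Function.Injective (A : H →ₗ[ℂ] H) :=
    (injective_iff_map_eq_zero (A : H →ₗ[ℂ] H)).2 h
  rw [ContinuousLinearMap.isUnit_iff_bijective]
  exact ⟨hinj, LinearMap.injective_iff_surjective.1 hinj⟩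

/-- A positive operator which defines a faithful functional is strictly positive. -/
lemma isStrictlyPositive_of_tr {A : H →L[ℂ] H} (hA : 0 ≤ A)
    (h : ∀ X, 0 ≤ X → tr (X * A) = 0 → X = 0) : IsStrictlyPositive A := by
  rw [IsStrictlyPositive.iff_of_unital]
  refine ⟨hA, isUnit_of_injective fun x hx => ?_⟩
  have h1 := h (InnerProductSpace.rankOne ℂ x x) (by
    rw [ContinuousLinearMap.nonneg_iff_isPositive]
    exact InnerProductSpace.isPositive_rankOne_self x)
    (by rw [tr_rankOne_mul, hx, inner_zero_right])
  have h2 := congrArg (fun f : H →L[ℂ] H => f x) h1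
  simpa using h2

lemma predualExp_nonneg {ρ : H →L[ℂ] H} (hρ : 0 ≤ ρ) : 0 ≤ predualExp E ρ := by
  refine nonneg_of_tr_mul fun X hX => ?_
  rw [predualExp, ← tr_map_mul]
  exact tr_mul_nonneg (cp_nonneg E hX) hρ

lemma tr_mul_predualExp (X ρ : H →L[ℂ] H) : tr (X * predualExp E ρ) = tr (E X * ρ) :=
  (tr_map_mul _ _ _).symm

lemma tr_mul_refState (X : H →L[ℂ] H) :
    tr (X * refState E) = (Module.finrank ℂ H : ℂ)⁻¹ * tr (E X) := by
  rw [refState, tr_mul_predualExp, mul_smul_comm, mul_one, tr_smul]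

lemma refState_nonneg : 0 ≤ refState E := by
  refine nonneg_of_tr_mul fun X hX => ?_
  rw [tr_mul_refState]
  refine mul_nonneg ?_ (tr_nonneg (cp_nonneg E hX))
  have : ((Module.finrank ℂ H : ℂ))⁻¹ = (((Module.finrank ℂ H : ℝ)⁻¹ : ℝ) : ℂ) := by push_cast; rfl
  rw [this]
  exact Complex.zero_le_real.2 (by positivity)

lemma predualExp_isState (hE : IsDFExpectation P σ E) {ρ : H →L[ℂ] H} (hρ : IsState ρ) :
    IsState (predualExp E ρ) := by
  refine ⟨predualExp_nonneg hρ.1, ?_⟩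
  rw [← one_mul (predualExp E ρ), tr_mul_predualExp, hE.map_one, one_mul, hρ.2]

/-- The reference state commutes with the decoherence-free algebra. -/
lemma refState_commute (hE : IsDFExpectation P σ E) {a : H →L[ℂ] H} (ha : a ∈ dfAlgebra P) :
    Commute (refState E) a := by
  refine ext_tr_mul fun X => ?_
  rw [← mul_assoc, tr_mul_comm, ← mul_assoc, tr_mul_refState, ← mul_assoc, tr_mul_refState,
    hE.map_mul_left ha, hE.map_mul_right ha, tr_mul_comm]

lemma tr_refState_mul_apply (hE : IsDFExpectation P σ E) (X : H →L[ℂ] H) :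
    tr (refState E * E X) = tr (refState E * X) := by
  rw [tr_mul_comm, tr_mul_refState, hE.idempotent, tr_mul_comm, tr_mul_refState]

/-- The reference state is invariant under the semigroup. -/
lemma tr_refState_mul_map (hE : IsDFExpectation P σ E) (t : ℝ≥0) (X : H →L[ℂ] H) :
    tr (refState E * P.map t X) = tr (refState E * X) := by
  rw [tr_mul_comm, tr_mul_refState, hE.comm, tr_map_of_mem (hE.mem X), tr_mul_comm,
    tr_mul_refState]

variable [Nontrivial H]

lemma finrank_inv_ne_zero : (Module.finrank ℂ H : ℂ)⁻¹ ≠ 0 :=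
  inv_ne_zero (Nat.cast_ne_zero.2 Module.finrank_pos.ne')

lemma tr_refState (hE : IsDFExpectation P σ E) : tr (refState E) = 1 := by
  rw [← one_mul (refState E), tr_mul_refState, hE.map_one, tr, ContinuousLinearMap.toLinearMap_one,
    LinearMap.trace_one]
  exact inv_mul_cancel₀ (Nat.cast_ne_zero.2 Module.finrank_pos.ne')

lemma refState_isState (hE : IsDFExpectation P σ E) : IsState (refState E) :=
  ⟨refState_nonneg, tr_refState hE⟩

lemma eq_zero_of_tr_apply (hE : IsDFExpectation P σ E) (hf : IsStrictlyPositive σ)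
    {X : H →L[ℂ] H} (hX : 0 ≤ X) (h : tr (E X) = 0) : X = 0 := by
  have h1 : E X = 0 := by
    obtain ⟨c, hc⟩ := exists_eq_star_mul_self (cp_nonneg E hX)
    rw [hc] at h ⊢
    rw [eq_zero_of_tr_star_mul_self h, mul_zero]
  refine eq_zero_of_tr_mul_eq_zero hf hX ?_
  rw [← hE.compatible, h1, mul_zero, tr_zero]

lemma refState_isStrictlyPositive (hE : IsDFExpectation P σ E) (hf : IsStrictlyPositive σ) :
    IsStrictlyPositive (refState E) := by
  refine isStrictlyPositive_of_tr refState_nonneg fun X hX h => ?_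
  rw [tr_mul_refState] at h
  exact eq_zero_of_tr_apply hE hf hX ((mul_eq_zero.1 h).resolve_left finrank_inv_ne_zero)

/-- The conditional expectation of a state has a density with respect to the reference state
which lies in the decoherence-free algebra. -/
lemma exists_density (hE : IsDFExpectation P σ E) (hf : IsStrictlyPositive σ) {ρ : H →L[ℂ] H}
    (hρ : 0 ≤ ρ) : ∃ ω ∈ dfAlgebra P, 0 ≤ ω ∧ refState E * ω = predualExp E ρ := by
  set s := refState E with hs
  have hsp : IsStrictlyPositive s := refState_isStrictlyPositive hE hf
  -- `E(ω) σ_Tr = ω σ_Tr` since `E` is symmetric for the trace pairing weighted by `σ_Tr`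
  set ω := predualExp E ρ * Ring.inverse s with hω
  have hωs : ω * s = predualExp E ρ := by
    rw [hω, mul_assoc, Ring.inverse_mul_cancel _ hsp.isUnit, mul_one]
  have h1 : E ω * s = ω * s := by
    refine ext_tr_mul fun X => ?_
    calc tr (X * (E ω * s)) = (Module.finrank ℂ H : ℂ)⁻¹ * tr (E X * E ω) := by
          rw [← mul_assoc, tr_mul_refState, hE.map_mul_right (hE.mem _)]
      _ = tr (E X * ω * s) := by rw [tr_mul_refState, hE.map_mul_left (hE.mem _)]
      _ = tr (X * (ω * s)) := by
        rw [mul_assoc, hωs, tr_mul_predualExp, hE.idempotent, ← tr_mul_predualExp]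
  have hmem : ω ∈ dfAlgebra P := by
    rw [← hsp.isUnit.mul_right_cancel h1]
    exact hE.mem ω
  have hcomm : Commute s ω := refState_commute hE hmem
  refine ⟨ω, hmem, ?_, by rw [hcomm.eq, hωs]⟩
  refine Commute.mul_nonneg (predualExp_nonneg hρ) hsp.ringInverse.nonneg ?_
  rw [commute_iff_eq, ← hω, ← hωs, ← hcomm.eq, Ring.inverse_mul_cancel_left _ _ hsp.isUnit]

end ExpectationProperties

/-! ### Differentiability of continuous semigroups -/

section Generator

open Filter Set MeasureTheory

variable {V : Type*} [NormedAddCommGroup V] [NormedSpace ℂ V] [FiniteDimensional ℂ V]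

/-- A continuous one-parameter semigroup on a finite dimensional space is differentiable. With
`M a = ∫₀ᵃ T_u du` one has `M a * T_t = M (t + a) - M t`, and `M a` is invertible for small
`a > 0`. -/
theorem exists_generator (T : ℝ≥0 → V →ₗ[ℂ] V) (h0 : ∀ x, T 0 x = x)
    (hadd : ∀ s t x, T (s + t) x = T s (T t x)) (hc : ∀ x, Continuous fun t => T t x) :
    ∃ L : V →ₗ[ℂ] V,
      (∀ x, HasDerivWithinAt (fun t : ℝ => T t.toNNReal x) (L x) (Ici 0) 0) ∧
      ∀ x (t : ℝ), 0 < t →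
        HasDerivAt (fun t : ℝ => T t.toNNReal x) (L (T t.toNNReal x)) t := by
  have : CompleteSpace V := FiniteDimensional.complete ℂ V
  let S : ℝ → (V →L[ℂ] V) := fun t => LinearMap.toContinuousLinearMap (T t.toNNReal)
  have hS : Continuous S := continuous_clm_apply.2 fun x =>
    (hc x).comp continuous_real_toNNReal
  have hS0 : S 0 = 1 := by ext x; simp [S, h0]
  have hSadd : ∀ s t, 0 ≤ s → 0 ≤ t → S (s + t) = S s * S t := by
    intro s t hs ht
    ext x
    simp [S, Real.toNNReal_add hs ht, hadd]
  let M : ℝ → (V →L[ℂ] V) := fun a => ∫ u in (0 : ℝ)..a, S u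
  have hM : ∀ a, HasDerivAt M (S a) a := fun a =>
    intervalIntegral.integral_hasDerivAt_right (hS.intervalIntegrable _ _)
      hS.stronglyMeasurable.stronglyMeasurableAtFilter hS.continuousAt
  -- `a⁻¹ • M a` tends to the identity as `a → 0⁺`
  have hunit : ∃ a, 0 < a ∧ IsUnit (M a) := by
    have h1 := (hM 0).tendsto_slope_zero_right
    rw [hS0] at h1
    have h2 : ∀ᶠ X in 𝓝 (1 : V →L[ℂ] V), IsUnit X := Units.isOpen.mem_nhds isUnit_one
    obtain ⟨a, ha, ha'⟩ := ((h1.eventually h2).and self_mem_nhdsWithin).exists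
    refine ⟨a, ha', ?_⟩
    have hM0 : M 0 = 0 := intervalIntegral.integral_same
    rw [zero_add, hM0, sub_zero] at ha
    have ha0 : a ≠ 0 := (show 0 < a from ha').ne'
    exact (isUnit_smul_iff (Units.mk0 a⁻¹ (inv_ne_zero ha0)) (M a)).1 ha
  obtain ⟨a, ha, u, hu⟩ := hunit
  have hMS : ∀ t, 0 ≤ t → M a * S t = M (t + a) - M t := by
    intro t ht
    have h1 : M a * S t = ∫ v in (0 : ℝ)..a, S v * S t :=
      (((ContinuousLinearMap.mul ℝ (V →L[ℂ] V)).flip (S t)).intervalIntegral_comp_comm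
        (hS.intervalIntegrable 0 a)).symm
    have h2 : ∫ v in (0 : ℝ)..a, S v * S t = ∫ v in (0 : ℝ)..a, S (v + t) := by
      refine intervalIntegral.integral_congr fun v hv => ?_
      rw [uIcc_of_le ha.le] at hv
      exact (hSadd v t hv.1 ht).symm
    rw [h1, h2, intervalIntegral.integral_comp_add_right, zero_add, add_comm a t]
    exact (intervalIntegral.integral_interval_sub_left (hS.intervalIntegrable _ _)
      (hS.intervalIntegrable _ _)).symm
  let g : ℝ → (V →L[ℂ] V) := fun t => ↑u⁻¹ * (M (t + a) - M t)
  have hSg : ∀ t, 0 ≤ t → S t = g t := by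
    intro t ht
    simp only [g]
    rw [← hMS t ht, ← hu, ← mul_assoc, Units.inv_mul, one_mul]
  have hg : ∀ t, 0 ≤ t → HasDerivAt g (↑u⁻¹ * (S a - 1) * S t) t := by
    intro t ht
    have h1 : HasDerivAt g (↑u⁻¹ * (S (t + a) - S t)) t :=
      (((hM (t + a)).comp_add_const t a).sub (hM t)).const_mul _
    rwa [add_comm t a, hSadd a t ha.le ht, show S a * S t - S t = (S a - 1) * S t by
      rw [sub_mul, one_mul], ← mul_assoc] at h1
  have happ : ∀ (x : V) (t : ℝ) (f' : V →L[ℂ] V) (s : Set ℝ), HasDerivWithinAt S f' s t →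
      HasDerivWithinAt (fun t : ℝ => T t.toNNReal x) (f' x) s t := by
    intro x t f' s h
    exact ((ContinuousLinearMap.apply ℂ V x).restrictScalars ℝ).hasFDerivAt.comp_hasDerivWithinAt
      t h
  refine ⟨((↑u⁻¹ * (S a - 1) : V →L[ℂ] V) : V →ₗ[ℂ] V), fun x => ?_, fun x t ht => ?_⟩
  · have h1 := (hg 0 le_rfl).hasDerivWithinAt (s := Ici 0)
    rw [hS0, mul_one] at h1
    exact happ x 0 _ _ (h1.congr (fun t ht => hSg t ht) (hSg 0 le_rfl))
  · have h1 := (hg t ht.le).congr_of_eventuallyEq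
      ((eventually_gt_nhds ht).mono fun s hs => hSg s hs.le)
    have h2 := happ x t _ univ h1.hasDerivWithinAt
    rw [hasDerivWithinAt_univ] at h2
    exact h2

end Generator

/-! ### Pinsker's inequality -/

section Pinsker

open Set

lemma log_sub_rational_monotoneOn :
    MonotoneOn (fun x : ℝ => Real.log x - 3 / 2 * ((x - 1) * (x + 5) / (x + 2) ^ 2)) (Ioi 0) := by
  have hd : ∀ x ∈ Ioi (0 : ℝ), HasDerivAt
      (fun x : ℝ => Real.log x - 3 / 2 * ((x - 1) * (x + 5) / (x + 2) ^ 2))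
      (1 / x - 27 / (x + 2) ^ 3) x := by
    intro x hx
    have hx : 0 < x := hx
    have e1 : HasDerivAt (fun x : ℝ => (x - 1) * (x + 5)) (1 * (x + 5) + (x - 1) * 1) x :=
      ((hasDerivAt_id' x).sub_const 1).mul ((hasDerivAt_id' x).add_const 5)
    have e2 : HasDerivAt (fun x : ℝ => (x + 2) ^ 2) (2 * (x + 2)) x := by
      simpa using ((hasDerivAt_id' x).add_const 2).fun_pow 2
    have h2 := (Real.hasDerivAt_log hx.ne').fun_sub
      ((e1.fun_div e2 (by positivity)).const_mul (3 / 2))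
    refine h2.congr_deriv ?_
    field_simp
    ring
  refine monotoneOn_of_deriv_nonneg (convex_Ioi 0)
    (fun x hx => (hd x hx).continuousAt.continuousWithinAt)
    (fun x hx => (hd x (interior_subset hx)).differentiableAt.differentiableWithinAt)
    fun x hx => ?_
  have hx' : 0 < x := interior_subset hx
  rw [(hd x hx').deriv, sub_nonneg, div_le_div_iff₀ (by positivity) hx']
  nlinarith [mul_nonneg (sq_nonneg (x - 1)) (by linarith : (0 : ℝ) ≤ x + 8)]

/-- The difference of the two sides vanishes at `x = 1` to first order, and its derivative is the
monotone function of `log_sub_rational_monotoneOn`. -/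
lemma mul_log_ge_rational {x : ℝ} (hx : 0 < x) :
    3 * (x - 1) ^ 2 / (2 * x + 4) ≤ x * Real.log x - x + 1 := by
  let φ : ℝ → ℝ := fun x => x * Real.log x - x + 1 - 3 * (x - 1) ^ 2 / (2 * x + 4)
  have hd : ∀ x ∈ Ioi (0 : ℝ), HasDerivAt φ
      (Real.log x - 3 / 2 * ((x - 1) * (x + 5) / (x + 2) ^ 2)) x := by
    intro x hx
    have hx : 0 < x := hx
    have e1 : HasDerivAt (fun x : ℝ => 3 * (x - 1) ^ 2) (3 * (2 * (x - 1))) x := by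
      simpa using (((hasDerivAt_id' x).sub_const 1).fun_pow 2).const_mul 3
    have e2 : HasDerivAt (fun x : ℝ => 2 * x + 4) 2 x := by
      simpa using ((hasDerivAt_id' x).const_mul 2).add_const 4
    have h2 := ((((hasDerivAt_id' x).fun_mul (Real.hasDerivAt_log hx.ne')).fun_sub
      (hasDerivAt_id' x)).add_const 1).fun_sub (e1.fun_div e2 (by positivity))
    refine h2.congr_deriv ?_
    field_simp
    ring
  have h0 := log_sub_rational_monotoneOn
  have hone : Real.log 1 - 3 / 2 * (((1 : ℝ) - 1) * (1 + 5) / (1 + 2) ^ 2) = 0 := by simp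
  have hφ1 : φ 1 = 0 := by simp [φ]
  have hmain : 0 ≤ φ x := by
    rw [← hφ1]
    rcases le_total 1 x with h | h
    · refine monotoneOn_of_deriv_nonneg (convex_Icc 1 x) (f := φ)
        (fun y hy => (hd y (lt_of_lt_of_le one_pos hy.1)).continuousAt.continuousWithinAt)
        (fun y hy => (hd y (lt_of_lt_of_le one_pos
          (interior_subset hy).1)).differentiableAt.differentiableWithinAt)
        (fun y hy => ?_) (left_mem_Icc.2 h) (right_mem_Icc.2 h) h
      have hy1 := (interior_subset hy).1
      rw [(hd y (lt_of_lt_of_le one_pos hy1)).deriv, ← hone]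
      exact h0 (mem_Ioi.2 one_pos) (mem_Ioi.2 (lt_of_lt_of_le one_pos hy1)) hy1
    · refine antitoneOn_of_deriv_nonpos (convex_Icc x 1) (f := φ)
        (fun y hy => (hd y (lt_of_lt_of_le hx hy.1)).continuousAt.continuousWithinAt)
        (fun y hy => (hd y (lt_of_lt_of_le hx
          (interior_subset hy).1)).differentiableAt.differentiableWithinAt)
        (fun y hy => ?_) (left_mem_Icc.2 h) (right_mem_Icc.2 h) h
      have hy1 := interior_subset hy
      rw [(hd y (lt_of_lt_of_le hx hy1.1)).deriv, ← hone]
      exact h0 (mem_Ioi.2 (lt_of_lt_of_le hx hy1.1)) (mem_Ioi.2 one_pos) hy1.2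
  simp only [φ] at hmain
  linarith

/-- The pointwise inequality behind Pinsker's inequality. Summed over two probability
distributions, the first factor on the right gives `2`, the constant of Pinsker's inequality. -/
lemma sq_sub_le_mul_entropy {p q : ℝ} (hp : 0 < p) (hq : 0 < q) :
    (p - q) ^ 2 ≤ (2 * p + 4 * q) / 3 * (p * (Real.log p - Real.log q) - p + q) := by
  have h := mul_log_ge_rational (div_pos hp hq)
  rw [div_le_iff₀ (by positivity), Real.log_div hp.ne' hq.ne'] at h
  have h2 := mul_le_mul_of_nonneg_left h (by positivity : (0 : ℝ) ≤ q ^ 2 / 3)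
  have e1 : q ^ 2 / 3 * (3 * (p / q - 1) ^ 2) = (p - q) ^ 2 := by field_simp
  have e2 : q ^ 2 / 3 * ((p / q * (Real.log p - Real.log q) - p / q + 1) * (2 * (p / q) + 4)) =
      (2 * p + 4 * q) / 3 * (p * (Real.log p - Real.log q) - p + q) := by
    field_simp
  rwa [e1, e2] at h2

variable {H : Type*} [NormedAddCommGroup H] [InnerProductSpace ℂ H] [CompleteSpace H]
  [FiniteDimensional ℂ H]

lemma exists_eigenbasis {X : H →L[ℂ] H} (hX : IsStrictlyPositive X) :
    ∃ (b : OrthonormalBasis (Fin (Module.finrank ℂ H)) ℂ H) (p : Fin (Module.finrank ℂ H) → ℝ),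
      ∀ i, X (b i) = (p i : ℂ) • b i ∧ 0 < p i := by
  have hs : (X : H →ₗ[ℂ] H).IsSymmetric :=
    ContinuousLinearMap.isSelfAdjoint_iff_isSymmetric.1 (IsSelfAdjoint.of_nonneg hX.nonneg)
  refine ⟨hs.eigenvectorBasis rfl, hs.eigenvalues rfl,
    fun i => ⟨hs.apply_eigenvectorBasis rfl i, ?_⟩⟩
  have h2 := mem_spectrum_iff_hasEigenvalue.2 (hs.hasEigenvalue_eigenvalues rfl i)
  refine lt_of_le_of_ne (spectrum_nonneg_of_nonneg hX.nonneg h2) fun h0 => ?_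
  rw [← h0] at h2
  exact spectrum.zero_notMem ℝ hX.isUnit h2

lemma tr_mul_of_eigenbasis_right {ι κ : Type*} [Fintype ι] [Fintype κ]
    (b : OrthonormalBasis ι ℂ H) (c : OrthonormalBasis κ ℂ H) {X : H →L[ℂ] H} {x : ι → ℝ}
    (hx : ∀ i, X (b i) = (x i : ℂ) • b i) (A : H →L[ℂ] H) :
    tr (A * X) = ∑ i, ∑ j, (x i : ℂ) * (⟪b i, c j⟫_ℂ * ⟪c j, A (b i)⟫_ℂ) := by
  rw [tr_eq_sum_inner b]
  refine Finset.sum_congr rfl fun i _ => ?_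
  rw [mul_apply_eq_comp, hx, map_smul, inner_smul_right, ← Finset.mul_sum,
    OrthonormalBasis.sum_inner_mul_inner]

lemma tr_mul_of_eigenbasis_left {ι κ : Type*} [Fintype ι] [Fintype κ]
    (b : OrthonormalBasis ι ℂ H) (c : OrthonormalBasis κ ℂ H) {Y : H →L[ℂ] H} {y : κ → ℝ}
    (hs : IsSelfAdjoint Y) (hy : ∀ j, Y (c j) = (y j : ℂ) • c j) (A : H →L[ℂ] H) :
    tr (Y * A) = ∑ i, ∑ j, (y j : ℂ) * (⟪b i, c j⟫_ℂ * ⟪c j, A (b i)⟫_ℂ) := by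
  rw [tr_eq_sum_inner b]
  refine Finset.sum_congr rfl fun i _ => ?_
  rw [mul_apply_eq_comp, ← OrthonormalBasis.sum_inner_mul_inner c]
  refine Finset.sum_congr rfl fun j _ => ?_
  have h1 : ⟪c j, Y (A (b i))⟫_ℂ = (y j : ℂ) * ⟪c j, A (b i)⟫_ℂ := by
    rw [← ContinuousLinearMap.adjoint_inner_left, ← ContinuousLinearMap.star_eq_adjoint,
      hs.star_eq, hy, inner_smul_left, Complex.conj_ofReal]
  rw [h1]
  ring

/-- Pinsker's inequality, tested against a contraction `U`. In eigenbases `(b_i, p_i)` of `ρ` and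
`(c_j, q_j)` of `τ`, the relative entropy is the classical one of `|⟨b_i, c_j⟩|² p_i` and
`|⟨b_i, c_j⟩|² q_j`, and `Tr[U (ρ - τ)]` is the sum of
`(p_i - q_j) ⟨b_i, c_j⟩ ⟨c_j, U b_i⟩`. -/
theorem sq_tr_mul_sub_le {ρ τ U : H →L[ℂ] H} (hρ : IsStrictlyPositive ρ)
    (hτ : IsStrictlyPositive τ) (hρ1 : tr ρ = 1) (hτ1 : tr τ = 1) (hU : ‖U‖ ≤ 1) :
    (tr (U * (ρ - τ))).re ^ 2 ≤ 2 * (tr (ρ * (CFC.log ρ - CFC.log τ))).re := by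
  obtain ⟨b, p, hb⟩ := exists_eigenbasis hρ
  obtain ⟨c, q, hc⟩ := exists_eigenbasis hτ
  have hρs := IsSelfAdjoint.of_nonneg hρ.nonneg
  have hτs := IsSelfAdjoint.of_nonneg hτ.nonneg
  have hlb : ∀ i, CFC.log ρ (b i) = (Real.log (p i) : ℂ) • b i := fun i =>
    cfc_apply_of_eigenvector _ hρs (hb i).1
  have hlc : ∀ j, CFC.log τ (c j) = (Real.log (q j) : ℂ) • c j := fun j =>
    cfc_apply_of_eigenvector _ hτs (hc j).1
  have hw : ∀ i j, ⟪b i, c j⟫_ℂ * ⟪c j, b i⟫_ℂ = ((‖⟪b i, c j⟫_ℂ‖ ^ 2 : ℝ) : ℂ) := by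
    intro i j
    rw [← inner_conj_symm (c j) (b i), Complex.mul_conj, Complex.normSq_eq_norm_sq]
  have e1 : (tr (ρ * CFC.log ρ)).re =
      ∑ i, ∑ j, p i * Real.log (p i) * ‖⟪b i, c j⟫_ℂ‖ ^ 2 := by
    have h := tr_mul_of_eigenbasis_right b c (X := ρ * CFC.log ρ)
      (x := fun i => p i * Real.log (p i)) (fun i => by
        rw [mul_apply_eq_comp, hlb, map_smul, (hb i).1, smul_smul, mul_comm]; push_cast; rfl) 1
    simp only [one_apply_eq_self, hw, one_mul] at h
    rw [h]
    simp [← Complex.ofReal_mul, ← Complex.ofReal_sum, -Complex.ofReal_pow]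
  have e2 : (tr (ρ * CFC.log τ)).re =
      ∑ i, ∑ j, p i * Real.log (q j) * ‖⟪b i, c j⟫_ℂ‖ ^ 2 := by
    have h := tr_mul_of_eigenbasis_left b c (Y := CFC.log τ) IsSelfAdjoint.log hlc ρ
    rw [tr_mul_comm, h]
    simp only [(hb _).1, inner_smul_right]
    rw [Complex.re_sum]
    refine Finset.sum_congr rfl fun i _ => ?_
    rw [Complex.re_sum]
    refine Finset.sum_congr rfl fun j _ => ?_
    rw [mul_left_comm (⟪b i, c j⟫_ℂ), hw, ← mul_assoc, ← Complex.ofReal_mul, ← Complex.ofReal_mul,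
      Complex.ofReal_re, mul_comm (p i)]
  have e3 : ∑ i, ∑ j, p i * ‖⟪b i, c j⟫_ℂ‖ ^ 2 = 1 := by
    have h := tr_mul_of_eigenbasis_right b c (fun i => (hb i).1) 1
    simp only [one_apply_eq_self, hw, one_mul, hρ1] at h
    exact_mod_cast h.symm
  have e4 : ∑ i, ∑ j, q j * ‖⟪b i, c j⟫_ℂ‖ ^ 2 = 1 := by
    have h := tr_mul_of_eigenbasis_left b c hτs (fun i => (hc i).1) 1
    simp only [one_apply_eq_self, hw, mul_one, hτ1] at h
    exact_mod_cast h.symm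
  have eD : (tr (ρ * (CFC.log ρ - CFC.log τ))).re = ∑ i, ∑ j,
      ‖⟪b i, c j⟫_ℂ‖ ^ 2 * (p i * (Real.log (p i) - Real.log (q j)) - p i + q j) := by
    have h5 : ∑ i, ∑ j,
        ‖⟪b i, c j⟫_ℂ‖ ^ 2 * (p i * (Real.log (p i) - Real.log (q j)) - p i + q j) =
        ∑ i, ∑ j, p i * Real.log (p i) * ‖⟪b i, c j⟫_ℂ‖ ^ 2
        - ∑ i, ∑ j, p i * Real.log (q j) * ‖⟪b i, c j⟫_ℂ‖ ^ 2
        - ∑ i, ∑ j, p i * ‖⟪b i, c j⟫_ℂ‖ ^ 2 + ∑ i, ∑ j, q j * ‖⟪b i, c j⟫_ℂ‖ ^ 2 := by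
      simp only [← Finset.sum_sub_distrib, ← Finset.sum_add_distrib]
      exact Finset.sum_congr rfl fun i _ => Finset.sum_congr rfl fun j _ => by ring
    rw [h5, e3, e4, mul_sub, tr_sub, Complex.sub_re, e1, e2]
    ring
  have eU : tr (U * (ρ - τ)) = ∑ i, ∑ j,
      ((p i - q j : ℝ) : ℂ) * (⟪b i, c j⟫_ℂ * ⟪c j, U (b i)⟫_ℂ) := by
    rw [mul_sub, tr_sub, tr_mul_comm U τ,
      tr_mul_of_eigenbasis_right b c (fun i => (hb i).1),
      tr_mul_of_eigenbasis_left b c hτs (fun i => (hc i).1)]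
    simp only [← Finset.sum_sub_distrib, Complex.ofReal_sub, sub_mul]
  have hU1 : ∀ i, ∑ j, ‖⟪c j, U (b i)⟫_ℂ‖ ^ 2 ≤ 1 := by
    intro i
    rw [OrthonormalBasis.sum_sq_norm_inner_right]
    have : ‖U (b i)‖ ≤ 1 := by
      simpa using (U.le_opNorm (b i)).trans (by simpa using hU)
    exact pow_le_one₀ (norm_nonneg _) this
  have hU2 : ∀ j, ∑ i, ‖⟪c j, U (b i)⟫_ℂ‖ ^ 2 ≤ 1 := by
    intro j
    simp only [← ContinuousLinearMap.adjoint_inner_left]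
    rw [OrthonormalBasis.sum_sq_norm_inner_left]
    have : ‖ContinuousLinearMap.adjoint U (c j)‖ ≤ 1 := by
      refine ((ContinuousLinearMap.adjoint U).le_opNorm (c j)).trans ?_
      simpa using hU
    exact pow_le_one₀ (norm_nonneg _) this
  have hbound : ∑ i, ∑ j, ‖⟪c j, U (b i)⟫_ℂ‖ ^ 2 * ((2 * p i + 4 * q j) / 3) ≤ 2 := by
    have hp1 : ∑ i, p i = 1 := by
      have h := e3
      simp only [← Finset.mul_sum, OrthonormalBasis.sum_sq_norm_inner_left] at h
      simpa using h
    have hq1 : ∑ j, q j = 1 := by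
      have h := e4
      rw [Finset.sum_comm] at h
      simp only [← Finset.mul_sum, OrthonormalBasis.sum_sq_norm_inner_right] at h
      simpa using h
    have h1 : ∑ i, ∑ j, ‖⟪c j, U (b i)⟫_ℂ‖ ^ 2 * p i ≤ 1 := by
      rw [← hp1]
      refine Finset.sum_le_sum fun i _ => ?_
      rw [← Finset.sum_mul]
      exact mul_le_of_le_one_left (hb i).2.le (hU1 i)
    have h2 : ∑ i, ∑ j, ‖⟪c j, U (b i)⟫_ℂ‖ ^ 2 * q j ≤ 1 := by
      rw [← hq1, Finset.sum_comm]
      refine Finset.sum_le_sum fun j _ => ?_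
      rw [← Finset.sum_mul]
      exact mul_le_of_le_one_left (hc j).2.le (hU2 j)
    have h3 : ∑ i, ∑ j, ‖⟪c j, U (b i)⟫_ℂ‖ ^ 2 * ((2 * p i + 4 * q j) / 3) =
        2 / 3 * ∑ i, ∑ j, ‖⟪c j, U (b i)⟫_ℂ‖ ^ 2 * p i +
        4 / 3 * ∑ i, ∑ j, ‖⟪c j, U (b i)⟫_ℂ‖ ^ 2 * q j := by
      simp only [Finset.mul_sum, ← Finset.sum_add_distrib]
      exact Finset.sum_congr rfl fun i _ => Finset.sum_congr rfl fun j _ => by ring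
    rw [h3]
    linarith
  have hh : ∀ i j, 0 ≤ p i * (Real.log (p i) - Real.log (q j)) - p i + q j := by
    intro i j
    have hp := (hb i).2
    have hq := (hc j).2
    exact nonneg_of_mul_nonneg_right
      ((sq_nonneg _).trans (sq_sub_le_mul_entropy hp hq)) (by positivity)
  have hCS : ‖tr (U * (ρ - τ))‖ ^ 2 ≤
      (∑ i, ∑ j, ‖⟪c j, U (b i)⟫_ℂ‖ ^ 2 * ((2 * p i + 4 * q j) / 3)) *
      (∑ i, ∑ j, ‖⟪b i, c j⟫_ℂ‖ ^ 2 *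
        (p i * (Real.log (p i) - Real.log (q j)) - p i + q j)) := by
    have h1 : ‖tr (U * (ρ - τ))‖ ≤ ∑ i, ∑ j,
        |p i - q j| * (‖⟪b i, c j⟫_ℂ‖ * ‖⟪c j, U (b i)⟫_ℂ‖) := by
      rw [eU]
      refine (norm_sum_le _ _).trans (Finset.sum_le_sum fun i _ => ?_)
      refine (norm_sum_le _ _).trans (Finset.sum_le_sum fun j _ => ?_)
      rw [norm_mul, norm_mul, Complex.norm_real, Real.norm_eq_abs]
    refine (pow_le_pow_left₀ (norm_nonneg _) h1 2).trans ?_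
    simp only [← Finset.sum_product']
    refine Finset.sum_sq_le_sum_mul_sum_of_sq_le_mul _ (fun x _ => ?_) (fun x _ => ?_)
      fun x _ => ?_
    · have hp := (hb x.1).2
      have hq := (hc x.2).2
      positivity
    · exact mul_nonneg (by positivity) (hh _ _)
    · have h2 := sq_sub_le_mul_entropy (hb x.1).2 (hc x.2).2
      have h3 := mul_le_mul_of_nonneg_left h2
        (by positivity : 0 ≤ ‖⟪b x.1, c x.2⟫_ℂ‖ ^ 2 * ‖⟪c x.2, U (b x.1)⟫_ℂ‖ ^ 2)
      rw [mul_pow, sq_abs, mul_pow]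
      linarith
  have hD0 : 0 ≤ ∑ i, ∑ j, ‖⟪b i, c j⟫_ℂ‖ ^ 2 *
      (p i * (Real.log (p i) - Real.log (q j)) - p i + q j) :=
    Finset.sum_nonneg fun i _ => Finset.sum_nonneg fun j _ => mul_nonneg (by positivity) (hh i j)
  have hre : (tr (U * (ρ - τ))).re ^ 2 ≤ ‖tr (U * (ρ - τ))‖ ^ 2 := by
    rw [← sq_abs]
    exact pow_le_pow_left₀ (abs_nonneg _) (Complex.abs_re_le_norm _) 2
  rw [eD]
  exact (hre.trans hCS).trans (mul_le_mul_of_nonneg_right hbound hD0)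

/-- The trace norm of a self-adjoint operator is attained at its sign. -/
lemma exists_sign {A : H →L[ℂ] H} (hA : IsSelfAdjoint A) : ∃ U : H →L[ℂ] H, IsSelfAdjoint U ∧
    U * U = 1 ∧ ‖U‖ ≤ 1 ∧ traceNorm A = (tr (U * A)).re := by
  -- the value `1` at `0` makes the sign a unitary
  let f : ℝ → ℝ := fun x => if x < 0 then -1 else 1
  have hU : IsSelfAdjoint (cfc f A) := cfc_predicate _ A
  have hUU : cfc f A * cfc f A = 1 := by
    rw [← cfc_mul _ _ _ (continuousOn_spectrum _ _) (continuousOn_spectrum _ _),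
      ← cfc_one (R := ℝ) A]
    refine cfc_congr fun x _ => ?_
    simp only [f, Pi.one_apply]
    split_ifs <;> simp
  refine ⟨cfc f A, hU, hUU, ?_, ?_⟩
  · have h1 : ‖cfc f A‖ * ‖cfc f A‖ ≤ 1 := by
      rw [← CStarRing.norm_star_mul_self, hU.star_eq, hUU]
      exact ContinuousLinearMap.norm_id_le
    nlinarith [norm_nonneg (cfc f A)]
  · rw [traceNorm, CFC.abs_eq_cfc_norm A hA]
    congr 2
    conv_rhs => rw [← cfc_id' ℝ A, cfc_id' ℝ A]
    nth_rewrite 3 [← cfc_id' ℝ A]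
    rw [← cfc_mul _ _ _ (continuousOn_spectrum _ _) (continuousOn_spectrum _ _)]
    refine cfc_congr fun x _ => ?_
    simp only [f, Real.norm_eq_abs]
    split_ifs with h
    · rw [abs_of_neg h]; ring
    · rw [abs_of_nonneg (not_lt.1 h)]; ring

/-- Pinsker's inequality for faithful states. -/
theorem pinsker {ρ τ : H →L[ℂ] H} (hρ : IsStrictlyPositive ρ)
    (hτ : IsStrictlyPositive τ) (hρ1 : tr ρ = 1) (hτ1 : tr τ = 1) :
    traceNorm (ρ - τ) ^ 2 ≤ 2 * (tr (ρ * (CFC.log ρ - CFC.log τ))).re := by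
  obtain ⟨U, -, -, hU, h⟩ := exists_sign
    ((IsSelfAdjoint.of_nonneg hρ.nonneg).sub (IsSelfAdjoint.of_nonneg hτ.nonneg))
  rw [h]
  exact sq_tr_mul_sub_le hρ hτ hρ1 hτ1 hU

/-- Klein's inequality. -/
lemma relEntropy_nonneg {ρ τ : H →L[ℂ] H} (hρ : IsStrictlyPositive ρ)
    (hτ : IsStrictlyPositive τ) (hρ1 : tr ρ = 1) (hτ1 : tr τ = 1) :
    0 ≤ (tr (ρ * (CFC.log ρ - CFC.log τ))).re := by
  nlinarith [pinsker hρ hτ hρ1 hτ1, sq_nonneg (traceNorm (ρ - τ))]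

end Pinsker

/-! ### Grönwall's inequality -/

section Decay

open scoped ComplexOrder
open Filter Set

/-- A differential form of Grönwall's inequality. -/
lemma le_mul_exp_of_deriv_le {g g' : ℝ → ℝ} {k : ℝ} (hc : ContinuousOn g (Ici 0))
    (hd : ∀ t, 0 < t → HasDerivAt g (g' t) t) (hg : ∀ t, 0 < t → g' t ≤ -k * g t) {t : ℝ}
    (ht : 0 ≤ t) : g t ≤ g 0 * Real.exp (-(k * t)) := by
  have hd' : ∀ t, 0 < t → HasDerivAt (fun t => g t * Real.exp (k * t))
      ((g' t + k * g t) * Real.exp (k * t)) t := by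
    intro t ht
    have h1 : HasDerivAt (fun t => Real.exp (k * t)) (Real.exp (k * t) * k) t := by
      simpa using ((hasDerivAt_id' t).const_mul k).exp
    exact ((hd t ht).fun_mul h1).congr_deriv (by ring)
  have hanti : AntitoneOn (fun t => g t * Real.exp (k * t)) (Ici 0) := by
    refine antitoneOn_of_deriv_nonpos (convex_Ici 0) (hc.mul (by fun_prop)) ?_ ?_
    · intro t ht
      rw [interior_Ici] at ht
      exact (hd' t ht).differentiableAt.differentiableWithinAt
    · intro t ht
      rw [interior_Ici] at ht
      rw [(hd' t ht).deriv]
      exact mul_nonpos_of_nonpos_of_nonneg (by linarith [hg t ht]) (Real.exp_nonneg _)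
  have h := hanti self_mem_Ici (mem_Ici.2 ht) ht
  simp only [mul_zero, Real.exp_zero, mul_one] at h
  rw [Real.exp_neg, ← div_eq_mul_inv, le_div_iff₀ (Real.exp_pos _)]
  exact h

end Decay

/-! ### Evolution in the Heisenberg and Schrödinger pictures -/

section Dynamics

open scoped ComplexOrder
open Filter Set

variable {H : Type*} [NormedAddCommGroup H] [InnerProductSpace ℂ H] [CompleteSpace H]
  [FiniteDimensional ℂ H] {P : QuantumMarkovSemigroup H}

lemma hasDerivAt_re_tr {Y : ℝ → H →L[ℂ] H} {Y' : H →L[ℂ] H} {t : ℝ} (h : HasDerivAt Y Y' t) :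
    HasDerivAt (fun t => (tr (Y t)).re) (tr Y').re t := by
  let f : (H →L[ℂ] H) →L[ℝ] ℝ := Complex.reCLM.comp ((trCLM (H := H)).restrictScalars ℝ)
  exact f.hasFDerivAt.comp_hasDerivAt t h

/-- The Lindbladian, defined as the right derivative at time zero, generates the semigroup. -/
lemma hasDerivAt_map (P : QuantumMarkovSemigroup H) (X : H →L[ℂ] H) {t : ℝ} (ht : 0 < t) :
    HasDerivAt (fun t : ℝ => P.map t.toNNReal X) (lindbladian P (P.map t.toNNReal X)) t := by
  obtain ⟨L, hL0, hL⟩ := exists_generator (fun t => (P.map t).toLinearMap) P.map_zero P.map_add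
    P.continuous
  have h1 : ∀ Y, lindbladian P Y = L Y := fun Y =>
    (hL0 Y).derivWithin (uniqueDiffOn_Ici 0 0 self_mem_Ici)
  rw [h1]
  exact hL X t ht

lemma tr_mul_predualMap (t : ℝ≥0) (X Y : H →L[ℂ] H) :
    tr (X * predualMap P t Y) = tr (P.map t X * Y) := (tr_map_mul _ _ _).symm

lemma predualMap_zero (Y : H →L[ℂ] H) : predualMap P 0 Y = Y :=
  ext_tr_mul fun X => by rw [tr_mul_predualMap, P.map_zero]

lemma predualMap_add (s t : ℝ≥0) (Y : H →L[ℂ] H) :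
    predualMap P (s + t) Y = predualMap P s (predualMap P t Y) :=
  ext_tr_mul fun X => by
    rw [tr_mul_predualMap, tr_mul_predualMap, tr_mul_predualMap, add_comm, P.map_add]

lemma continuous_predualMap (P : QuantumMarkovSemigroup H) (Y : H →L[ℂ] H) :
    Continuous fun t => predualMap P t Y := by
  have h : ∀ i j, Continuous fun t => tr (P.map t (InnerProductSpace.rankOne ℂ
      (stdOrthonormalBasis ℂ H j) (stdOrthonormalBasis ℂ H i)) * Y) := fun i j =>
    continuous_tr.comp ((P.continuous _).mul continuous_const)
  change Continuous fun t => ∑ i, ∑ j, tr (P.map t (InnerProductSpace.rankOne ℂ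
    (stdOrthonormalBasis ℂ H j) (stdOrthonormalBasis ℂ H i)) * Y) •
      InnerProductSpace.rankOne ℂ (stdOrthonormalBasis ℂ H i) (stdOrthonormalBasis ℂ H j)
  exact continuous_finsetSum _ fun i _ => continuous_finsetSum _ fun j _ =>
    (h i j).smul continuous_const

lemma hasDerivAt_predualMap (P : QuantumMarkovSemigroup H) (Y : H →L[ℂ] H) {t : ℝ} (ht : 0 < t) :
    HasDerivAt (fun t : ℝ => predualMap P t.toNNReal Y)
      (predualLindbladian P (predualMap P t.toNNReal Y)) t := by
  obtain ⟨L, hL0, hL⟩ := exists_generator (predualMap P) predualMap_zero predualMap_add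
    (continuous_predualMap P)
  have h1 : ∀ Y, predualLindbladian P Y = L Y := fun Y =>
    (hL0 Y).derivWithin (uniqueDiffOn_Ici 0 0 self_mem_Ici)
  rw [h1]
  exact hL Y t ht

lemma predualMap_nonneg {ρ : H →L[ℂ] H} (hρ : 0 ≤ ρ) (t : ℝ≥0) : 0 ≤ predualMap P t ρ := by
  refine nonneg_of_tr_mul fun X hX => ?_
  rw [tr_mul_predualMap]
  exact tr_mul_nonneg (cp_nonneg _ hX) hρ

lemma tr_predualMap (ρ : H →L[ℂ] H) (t : ℝ≥0) : tr (predualMap P t ρ) = tr ρ := by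
  rw [← one_mul (predualMap P t ρ), tr_mul_predualMap, P.map_one, one_mul]

lemma predualMap_isState {ρ : H →L[ℂ] H} (hρ : IsState ρ) (t : ℝ≥0) :
    IsState (predualMap P t ρ) :=
  ⟨predualMap_nonneg hρ.1 t, by rw [tr_predualMap, hρ.2]⟩

lemma predualMap_predualExp {σ : H →L[ℂ] H} {E : (H →L[ℂ] H) →CP (H →L[ℂ] H)}
    (hE : IsDFExpectation P σ E) (ρ : H →L[ℂ] H) (t : ℝ≥0) :
    predualMap P t (predualExp E ρ) = predualExp E (predualMap P t ρ) :=
  ext_tr_mul fun X => by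
    rw [tr_mul_predualMap, tr_mul_predualExp, tr_mul_predualExp, tr_mul_predualMap, hE.comm]

end Dynamics

/-! ### The smallest eigenvalue and the weighted inner product -/

section Poincare

open scoped ComplexOrder
open Filter Set

variable {H : Type*} [NormedAddCommGroup H] [InnerProductSpace ℂ H] [CompleteSpace H]
  [FiniteDimensional ℂ H]

/-- The difference of the two sides is half of the squared Hilbert-Schmidt norm of the
commutator. -/
lemma tr_mul_mul_mul_le {A B : H →L[ℂ] H} (hA : IsSelfAdjoint A) (hB : IsSelfAdjoint B) :
    (tr (A * B * A * B)).re ≤ (tr (A * A * (B * B))).re := by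
  have h1 := (Complex.nonneg_iff.1 (tr_nonneg (star_mul_self_nonneg (A * B - B * A)))).1
  have h2 : tr (star (A * B - B * A) * (A * B - B * A)) =
      2 * (tr (A * A * (B * B)) - tr (A * B * A * B)) := by
    rw [star_sub, star_mul, star_mul, hA.star_eq, hB.star_eq]
    have e1 : tr (B * A * (A * B)) = tr (A * A * (B * B)) := by
      rw [mul_assoc, tr_mul_comm]; simp only [mul_assoc]
    have e2 : tr (B * A * (B * A)) = tr (A * B * A * B) := by
      rw [mul_assoc, tr_mul_comm]; simp only [mul_assoc]
    have e3 : tr (A * B * (B * A)) = tr (A * A * (B * B)) := by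
      rw [← mul_assoc, tr_mul_comm]; simp only [mul_assoc]
    rw [sub_mul, mul_sub, mul_sub, tr_sub, tr_sub, tr_sub, e1, e2, e3, ← mul_assoc (A * B) A B]
    ring
  rw [h2] at h1
  simp only [Complex.mul_re, Complex.sub_re, Complex.re_ofNat, Complex.im_ofNat, zero_mul,
    sub_zero] at h1
  linarith

lemma isState_le_one {ρ : H →L[ℂ] H} (hρ : IsState ρ) : ρ ≤ 1 := by
  rw [← sub_nonneg, nonneg_iff_inner]
  intro x
  have h1 : 0 ≤ ((‖x‖ ^ 2 : ℝ) : ℂ) • (1 : H →L[ℂ] H) - InnerProductSpace.rankOne ℂ x x := by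
    rw [nonneg_iff_inner]
    intro y
    simp only [sub_apply, smul_apply, one_apply_eq_self, InnerProductSpace.rankOne_apply,
      inner_sub_right, inner_smul_right, inner_self_eq_norm_sq_to_K]
    rw [← inner_conj_symm y x, Complex.mul_conj, Complex.normSq_eq_norm_sq]
    have h2 := norm_inner_le_norm (𝕜 := ℂ) x y
    have h3 : ‖⟪x, y⟫_ℂ‖ ^ 2 ≤ ‖x‖ ^ 2 * ‖y‖ ^ 2 := by
      rw [← mul_pow]
      exact pow_le_pow_left₀ (norm_nonneg _) h2 2
    have h4 : (0 : ℂ) ≤ ((‖x‖ ^ 2 * ‖y‖ ^ 2 - ‖⟪x, y⟫_ℂ‖ ^ 2 : ℝ) : ℂ) :=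
      Complex.zero_le_real.2 (by linarith)
    push_cast at h4 ⊢
    exact h4
  have h2 := tr_mul_nonneg h1 hρ.1
  rw [sub_mul, tr_sub, smul_mul_assoc, one_mul, tr_smul, hρ.2, tr_rankOne_mul, mul_one] at h2
  rw [sub_apply, one_apply_eq_self, inner_sub_right, inner_self_eq_norm_sq_to_K]
  push_cast at h2
  exact h2

lemma tr_mul_self_le_one {ρ : H →L[ℂ] H} (hρ : IsState ρ) : (tr (ρ * ρ)).re ≤ 1 := by
  have := tr_mul_re_le hρ.1 (isState_le_one hρ)
  rwa [mul_one, hρ.2, Complex.one_re] at this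

lemma minEigenvalue_mem [Nontrivial H] {X : H →L[ℂ] H} (hX : IsSelfAdjoint X) :
    minEigenvalue X ∈ spectrum ℝ X ∧ ∀ μ ∈ spectrum ℝ X, minEigenvalue X ≤ μ := by
  have h1 : {μ : ℝ | Module.End.HasEigenvalue (X : H →ₗ[ℂ] H) (μ : ℂ)} = spectrum ℝ X := by
    ext μ
    exact mem_spectrum_iff_hasEigenvalue.symm
  rw [minEigenvalue, h1]
  have h2 := ContinuousFunctionalCalculus.spectrum_nonempty (R := ℝ) X hX
  exact ⟨h2.csInf_mem (finite_spectrum X), fun μ hμ => csInf_le (finite_spectrum X).bddBelow hμ⟩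

lemma minEigenvalue_pos [Nontrivial H] {X : H →L[ℂ] H} (hX : IsStrictlyPositive X) :
    0 < minEigenvalue X := by
  have h1 := (minEigenvalue_mem (IsSelfAdjoint.of_nonneg hX.nonneg)).1
  refine lt_of_le_of_ne (spectrum_nonneg_of_nonneg hX.nonneg h1) fun h0 => ?_
  rw [← h0] at h1
  exact spectrum.zero_notMem ℝ hX.isUnit h1

lemma algebraMap_minEigenvalue_le [Nontrivial H] {X : H →L[ℂ] H} (hX : IsSelfAdjoint X) :
    algebraMap ℝ (H →L[ℂ] H) (minEigenvalue X) ≤ X :=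
  algebraMap_le_of_le_spectrum (minEigenvalue_mem hX).2 hX

lemma ringInverse_le_algebraMap [Nontrivial H] {X : H →L[ℂ] H} (hX : IsStrictlyPositive X) :
    Ring.inverse X ≤ algebraMap ℝ (H →L[ℂ] H) (1 / minEigenvalue X) := by
  have hpos := minEigenvalue_pos hX
  have h1 : IsUnit (algebraMap ℝ (H →L[ℂ] H) (minEigenvalue X)) :=
    (IsUnit.mk0 _ hpos.ne').map _
  have h0 : 0 ≤ algebraMap ℝ (H →L[ℂ] H) (minEigenvalue X) := algebraMap_nonneg _ hpos.le
  have h2 := CStarAlgebra.ringInverse_le_ringInverse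
    (algebraMap_minEigenvalue_le (IsSelfAdjoint.of_nonneg hX.nonneg))
    (IsStrictlyPositive.iff_of_unital.2 ⟨h0, h1⟩)
  refine h2.trans_eq (h1.mul_right_cancel ?_)
  rw [Ring.inverse_mul_cancel _ h1, ← map_mul, one_div_mul_cancel hpos.ne', map_one]

lemma weightedInner_self_nonneg {s : H →L[ℂ] H} (X : H →L[ℂ] H) :
    0 ≤ (weightedInner s X X).re := by
  rw [weightedInner, mul_assoc, mul_assoc]
  refine tr_mul_re_nonneg (CFC.sqrt_nonneg s) ?_
  rw [← mul_assoc]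
  exact star_left_conjugate_nonneg (CFC.sqrt_nonneg s) X

lemma weightedInner_conj (s X Y : H →L[ℂ] H) :
    (weightedInner s X Y).re = (weightedInner s Y X).re := by
  have hw : star (CFC.sqrt s) = CFC.sqrt s := (IsSelfAdjoint.of_nonneg (CFC.sqrt_nonneg s)).star_eq
  have h : weightedInner s Y X = star (weightedInner s X Y) := by
    rw [weightedInner, weightedInner, ← tr_star]
    simp only [star_mul, star_star, hw]
    rw [mul_assoc, mul_assoc, tr_mul_comm]
    simp only [mul_assoc]
  rw [h]
  rfl

/-- The Cauchy-Schwarz inequality for the weighted inner product of `w⁻¹ ρ w⁻¹` and `Y`, where `w`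
is the square root of the weight. -/
lemma sq_tr_mul_le_weightedInner [Nontrivial H] {s : H →L[ℂ] H} (hs : IsStrictlyPositive s)
    {ρ : H →L[ℂ] H} (hρ : IsState ρ) (Y : H →L[ℂ] H) :
    (tr (ρ * Y)).re ^ 2 ≤ 1 / minEigenvalue s * (weightedInner s Y Y).re := by
  set w := CFC.sqrt s with hw
  have hwu : IsUnit w := hs.isUnit_cfcSqrt
  have hws : IsSelfAdjoint w := IsSelfAdjoint.of_nonneg (CFC.sqrt_nonneg s)
  have hww : w * w = s := CFC.sqrt_mul_sqrt_self s hs.nonneg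
  set v := Ring.inverse w with hv
  have hvw : v * w = 1 := Ring.inverse_mul_cancel _ hwu
  have hwv : w * v = 1 := Ring.mul_inverse_cancel _ hwu
  have hvs : IsSelfAdjoint v := by
    have h1 : star v * w = 1 := by rw [← hws.star_eq, ← star_mul, hwv, star_one]
    exact hwu.mul_right_cancel (h1.trans hvw.symm)
  have hvv : v * v = Ring.inverse s := by
    refine hs.isUnit.mul_right_cancel ?_
    rw [Ring.inverse_mul_cancel _ hs.isUnit, ← hww, mul_assoc, ← mul_assoc v w w, hvw, one_mul, hvw]
  have hρs : star ρ = ρ := (IsSelfAdjoint.of_nonneg hρ.1).star_eq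
  set A := v * ρ * v with hA
  have hAs : star A = A := by rw [hA, star_mul, star_mul, hvs.star_eq, hρs, mul_assoc]
  have hwAw : w * A * w = ρ := by
    rw [hA, ← mul_assoc, ← mul_assoc, hwv, one_mul, mul_assoc, hvw, mul_one]
  have hAY : weightedInner s A Y = tr (ρ * Y) := by
    rw [weightedInner, hAs, ← hw, hwAw]
  have hAA : (weightedInner s A A).re ≤ 1 / minEigenvalue s := by
    have h1 : weightedInner s A A = tr (ρ * v * ρ * v) := by
      rw [weightedInner, hAs, ← hw, hwAw, hA]; simp only [mul_assoc]
    have h2 := tr_mul_mul_mul_le (IsSelfAdjoint.of_nonneg hρ.1) hvs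
    have h3 : (tr (ρ * ρ * (v * v))).re ≤
        (tr (ρ * ρ * algebraMap ℝ (H →L[ℂ] H) (1 / minEigenvalue s))).re := by
      refine tr_mul_re_le ?_ (hvv ▸ ringInverse_le_algebraMap hs)
      have := star_mul_self_nonneg ρ
      rwa [hρs] at this
    rw [Algebra.algebraMap_eq_smul_one, mul_smul_comm, mul_one, tr_real_smul,
      Complex.re_ofReal_mul] at h3
    rw [h1]
    refine h2.trans (h3.trans ?_)
    exact mul_le_of_le_one_right (one_div_pos.2 (minEigenvalue_pos hs)).le (tr_mul_self_le_one hρ)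
  have hquad : ∀ x : ℝ, 0 ≤ (weightedInner s A A).re * (x * x) + 2 * (tr (ρ * Y)).re * x +
      (weightedInner s Y Y).re := by
    intro x
    have h1 := weightedInner_self_nonneg (s := s) ((x : ℂ) • A + Y)
    have h2 : weightedInner s ((x : ℂ) • A + Y) ((x : ℂ) • A + Y) =
        x * x * weightedInner s A A + x * (weightedInner s A Y + weightedInner s Y A) +
          weightedInner s Y Y := by
      simp only [weightedInner, star_add, star_smul, mul_add, add_mul, mul_smul_comm,
        smul_mul_assoc, tr_add, tr_smul, RCLike.star_def, Complex.conj_ofReal]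
      ring
    have h3 := weightedInner_conj s A Y
    rw [h2] at h1
    simp only [← Complex.ofReal_mul, Complex.add_re, Complex.re_ofReal_mul, ← h3, hAY] at h1
    linarith
  have hdisc := discrim_le_zero hquad
  rw [discrim] at hdisc
  have := mul_le_mul_of_nonneg_right hAA (weightedInner_self_nonneg (s := s) Y)
  nlinarith

end Poincare

/-! ### Decay from the Poincaré inequality -/

section PoincareDecay

open scoped ComplexOrder
open Filter Set

variable {H : Type*} [NormedAddCommGroup H] [InnerProductSpace ℂ H] [CompleteSpace H]
  [FiniteDimensional ℂ H] {P : QuantumMarkovSemigroup H} {σ : H →L[ℂ] H}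
  {E : (H →L[ℂ] H) →CP (H →L[ℂ] H)}

lemma weightedInner_self_le_tr {s U : H →L[ℂ] H} (hs : 0 ≤ s) (hU : IsSelfAdjoint U)
    (hUU : U * U = 1) : (weightedInner s U U).re ≤ (tr s).re := by
  have h := tr_mul_mul_mul_le (IsSelfAdjoint.of_nonneg (CFC.sqrt_nonneg s)) hU
  rw [hUU, mul_one, CFC.sqrt_mul_sqrt_self s hs] at h
  rwa [weightedInner, hU.star_eq]

/-- The conditional expectation is an orthogonal projection for the weighted inner product, so the
variance is at most the squared norm. -/
lemma dfVariance_le (hE : IsDFExpectation P σ E) (X : H →L[ℂ] H) :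
    dfVariance E X ≤ (weightedInner (refState E) X X).re := by
  set s := refState E with hs
  have hw : ∀ a ∈ dfAlgebra P, Commute (CFC.sqrt s) a := fun a ha => by
    rw [CFC.sqrt_eq_cfc]
    exact (refState_commute hE ha).cfc_nnreal _
  have hcross : weightedInner s (E X) (X - E X) = 0 := by
    have hm := star_mem_dfAlgebra (hE.mem X)
    rw [weightedInner, mul_assoc (CFC.sqrt s), ← (hw _ hm).eq, ← mul_assoc,
      CFC.sqrt_mul_sqrt_self s refState_nonneg, mul_assoc, ← tr_refState_mul_apply hE,
      hE.map_mul_left hm, map_sub, hE.idempotent, sub_self, mul_zero, mul_zero, tr_zero]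
  have hsplit : weightedInner s X X = weightedInner s (X - E X) (X - E X) +
      weightedInner s (E X) (X - E X) + weightedInner s (X - E X) (E X) +
        weightedInner s (E X) (E X) := by
    simp only [weightedInner, star_sub, mul_sub, sub_mul, tr_sub]
    ring
  have h1 := congrArg Complex.re hsplit
  simp only [Complex.add_re, weightedInner_conj s (X - E X) (E X), hcross, Complex.zero_re] at h1
  have h2 := weightedInner_self_nonneg (s := s) (E X)
  rw [dfVariance, ← hs]
  linarith

lemma hasDerivAt_weightedInner (s : H →L[ℂ] H) {Y : ℝ → H →L[ℂ] H} {Y' : H →L[ℂ] H} {t : ℝ}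
    (h : HasDerivAt Y Y' t) : HasDerivAt (fun t => (weightedInner s (Y t) (Y t)).re)
      (2 * (weightedInner s (Y t) Y').re) t := by
  have h1 : HasDerivAt (fun t => CFC.sqrt s * star (Y t) * CFC.sqrt s * Y t)
      (CFC.sqrt s * star Y' * CFC.sqrt s * Y t + CFC.sqrt s * star (Y t) * CFC.sqrt s * Y') t :=
    ((h.star.const_mul _).mul_const _).fun_mul h
  refine (hasDerivAt_re_tr h1).congr_deriv ?_
  rw [tr_add, Complex.add_re]
  change (weightedInner s Y' (Y t)).re + (weightedInner s (Y t) Y').re = _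
  rw [weightedInner_conj s Y' (Y t)]
  ring

variable [Nontrivial H]

lemma dfVariance_le_one (hE : IsDFExpectation P σ E) {U : H →L[ℂ] H} (hU : IsSelfAdjoint U)
    (hUU : U * U = 1) : dfVariance E U ≤ 1 := by
  refine (dfVariance_le hE U).trans ?_
  have h := weightedInner_self_le_tr (refState_nonneg (E := E)) hU hUU
  rwa [tr_refState hE, Complex.one_re] at h

/-- Testing the trace norm at time `t` against a self-adjoint unitary `U` and passing to the
Heisenberg picture bounds it by the weighted norm of `P_t(U - E(U))`. -/
lemma exists_sq_traceNorm_le (hE : IsDFExpectation P σ E) (hf : IsStrictlyPositive σ)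
    {ρ : H →L[ℂ] H} (hρ : IsState ρ) (t : ℝ≥0) : ∃ U : H →L[ℂ] H, IsSelfAdjoint U ∧ U * U = 1 ∧
    traceNorm (predualMap P t (ρ - predualExp E ρ)) ^ 2 ≤ 1 / minEigenvalue (refState E) *
      (weightedInner (refState E) (P.map t (U - E U)) (P.map t (U - E U))).re := by
  have hA : IsSelfAdjoint (predualMap P t (ρ - predualExp E ρ)) := by
    rw [map_sub]
    exact (IsSelfAdjoint.of_nonneg (predualMap_nonneg hρ.1 t)).sub
      (IsSelfAdjoint.of_nonneg (predualMap_nonneg (predualExp_nonneg hρ.1) t))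
  obtain ⟨U, hU, hUU, -, hUA⟩ := exists_sign hA
  refine ⟨U, hU, hUU, ?_⟩
  have hval : traceNorm (predualMap P t (ρ - predualExp E ρ)) =
      (tr (ρ * P.map t (U - E U))).re := by
    rw [hUA, tr_mul_predualMap, mul_sub, tr_sub, tr_mul_predualExp, hE.comm, ← tr_sub, ← sub_mul,
      ← map_sub, tr_mul_comm]
  rw [hval]
  exact sq_tr_mul_le_weightedInner (refState_isStrictlyPositive hE hf) hρ _

/-- Convergence in trace norm under the decoherence-free Poincaré inequality with constant `c`:
the weighted norm of `Y_t = P_t(U - E(U))` decays at rate `c`, since `E(Y_t) = 0`. -/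
theorem traceNorm_le_of_poincare (hE : IsDFExpectation P σ E) (hf : IsStrictlyPositive σ)
    {c : ℝ} (hc : ∀ X : H →L[ℂ] H, IsSelfAdjoint X → c * dfVariance E X ≤ dirichletForm P E X)
    {ρ : H →L[ℂ] H} (hρ : IsState ρ) (t : ℝ≥0) :
    traceNorm (predualMap P t (ρ - predualExp E ρ)) ≤
      Real.sqrt (1 / minEigenvalue (refState E)) * Real.exp (-(c * t)) := by
  obtain ⟨U, hU, hUU, hbound⟩ := exists_sq_traceNorm_le hE hf hρ t
  let Y : ℝ → H →L[ℂ] H := fun r => P.map r.toNNReal (U - E U)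
  let g : ℝ → ℝ := fun r => (weightedInner (refState E) (Y r) (Y r)).re
  have hEY0 : E (U - E U) = 0 := by rw [map_sub, hE.idempotent, sub_self]
  have hEY : ∀ r, E (Y r) = 0 := fun r => hE.map_apply_eq_zero hEY0 _
  have hYs : ∀ r, IsSelfAdjoint (Y r) := fun r =>
    cp_isSelfAdjoint _ (P.map_one _) (hU.sub (cp_isSelfAdjoint _ hE.map_one hU))
  have hYc : Continuous Y := (P.continuous _).comp continuous_real_toNNReal
  have hgc : Continuous g := by
    refine Complex.continuous_re.comp (continuous_tr.comp ?_)
    exact ((continuous_const.mul hYc.star).mul continuous_const).mul hYc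
  have hgd : ∀ r, 0 < r → HasDerivAt g
      (2 * (weightedInner (refState E) (Y r) (lindbladian P (Y r))).re) r := fun r hr =>
    hasDerivAt_weightedInner _ (hasDerivAt_map P (U - E U) hr)
  have hg' : ∀ r, 0 < r → 2 * (weightedInner (refState E) (Y r) (lindbladian P (Y r))).re ≤
      -(2 * c) * g r := by
    intro r _
    have h := hc (Y r) (hYs r)
    rw [dfVariance, hEY, sub_zero, dirichletForm] at h
    simp only [g]
    linarith
  have hdecay := le_mul_exp_of_deriv_le hgc.continuousOn hgd hg' t.2
  have hg0 : g 0 ≤ 1 := by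
    have h1 : g 0 = dfVariance E U := by
      simp only [g, Y, Real.toNNReal_zero, P.map_zero, dfVariance]
    rw [h1]
    exact dfVariance_le_one hE hU hUU
  have hgt : g t ≤ Real.exp (-(c * t)) ^ 2 := by
    rw [← Real.exp_nat_mul]
    refine hdecay.trans ((mul_le_of_le_one_left (Real.exp_nonneg _) hg0).trans_eq ?_)
    congr 1
    push_cast
    change -(2 * c * (t : ℝ)) = _
    ring
  have hpos : 0 ≤ 1 / minEigenvalue (refState E) :=
    (one_div_pos.2 (minEigenvalue_pos (refState_isStrictlyPositive hE hf))).le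
  refine le_of_sq_le_sq ?_ (by positivity)
  rw [mul_pow, Real.sq_sqrt hpos]
  simp only [g, Y, Real.toNNReal_coe] at hgt
  exact hbound.trans (mul_le_mul_of_nonneg_left hgt hpos)

/-- The bound without decay, which needs no Poincaré inequality: apply the time zero estimate to the
state `P_{*t}(ρ)`. -/
theorem traceNorm_le_sqrt (hE : IsDFExpectation P σ E) (hf : IsStrictlyPositive σ)
    {ρ : H →L[ℂ] H} (hρ : IsState ρ) (t : ℝ≥0) :
    traceNorm (predualMap P t (ρ - predualExp E ρ)) ≤
      Real.sqrt (1 / minEigenvalue (refState E)) := by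
  obtain ⟨U, hU, hUU, hbound⟩ := exists_sq_traceNorm_le hE hf (predualMap_isState hρ t) 0
  rw [predualMap_zero, P.map_zero, ← predualMap_predualExp hE, ← map_sub] at hbound
  have hpos : 0 ≤ 1 / minEigenvalue (refState E) :=
    (one_div_pos.2 (minEigenvalue_pos (refState_isStrictlyPositive hE hf))).le
  refine Real.le_sqrt_of_sq_le (hbound.trans ?_)
  exact mul_le_of_le_one_right hpos (dfVariance_le_one hE hU hUU)

end PoincareDecay

/-! ### Extended decay rates -/

section Exponents

open scoped ComplexOrder
open Filter Set

/-- Real exponential bounds for every rate below `a` give the bound with the extended rate `a`. -/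
lemma ofReal_le_mul_exp {L K : ℝ} {a : EReal} {t : ℝ≥0} (hK : 0 ≤ K) (hL : L ≤ K)
    (h : ∀ c : ℝ, (c : EReal) < a → L ≤ K * Real.exp (-(c * t))) :
    ENNReal.ofReal L ≤ ENNReal.ofReal K * EReal.exp (-(a * ((t : ℝ) : EReal))) := by
  rcases eq_or_ne t 0 with rfl | ht
  · simpa using ENNReal.ofReal_le_ofReal hL
  have htpos : 0 < (t : ℝ) := by positivity
  induction a with
  | bot =>
    rw [EReal.bot_mul_coe_of_pos htpos, EReal.neg_bot, EReal.exp_top]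
    rcases hK.eq_or_lt with h0 | h0
    · rw [ENNReal.ofReal_of_nonpos (hL.trans h0.symm.le)]
      exact zero_le
    · rw [ENNReal.mul_top (by simpa using h0)]
      exact le_top
  | coe a =>
    rw [← EReal.coe_mul, ← EReal.coe_neg, EReal.exp_coe, ← ENNReal.ofReal_mul hK]
    refine ENNReal.ofReal_le_ofReal ?_
    have hcont : Tendsto (fun c : ℝ => K * Real.exp (-(c * t))) (𝓝[<] a)
        (𝓝 (K * Real.exp (-(a * t)))) :=
      (Continuous.tendsto (by fun_prop) a).mono_left nhdsWithin_le_nhds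
    exact ge_of_tendsto hcont (eventually_mem_nhdsWithin.mono fun c hc =>
      h c (EReal.coe_lt_coe_iff.2 hc))
  | top =>
    have hlim : Tendsto (fun c : ℝ => K * Real.exp (-(c * t))) atTop (𝓝 (K * 0)) :=
      (Real.tendsto_exp_neg_atTop_nhds_zero.comp
        (tendsto_id.atTop_mul_const htpos)).const_mul K
    have h0 : L ≤ K * 0 := ge_of_tendsto' hlim fun c => h c (EReal.coe_lt_top c)
    rw [mul_zero] at h0
    rw [ENNReal.ofReal_of_nonpos h0]
    exact zero_le

end Exponents

/-! ### Decay of the relative entropy -/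

section Entropy

open scoped ComplexOrder
open Filter Set

variable {H : Type*} [NormedAddCommGroup H] [InnerProductSpace ℂ H] [CompleteSpace H]
  [FiniteDimensional ℂ H]

/-- For commuting operators the logarithm is additive, as the exponential is multiplicative. -/
lemma log_mul_of_commute {a b : H →L[ℂ] H} (ha : IsStrictlyPositive a) (hb : IsStrictlyPositive b)
    (h : Commute a b) : CFC.log (a * b) = CFC.log a + CFC.log b := by
  let _ : NormedAlgebra ℚ (H →L[ℂ] H) := NormedAlgebra.restrictScalars ℚ ℝ _
  have hcomm : Commute (CFC.log a) (CFC.log b) := (((h.cfc_real Real.log).symm).cfc_real _).symm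
  rw [← CFC.exp_log a ha, ← CFC.exp_log b hb, ← NormedSpace.exp_add_of_commute hcomm,
    CFC.log_exp _ (IsSelfAdjoint.log.add IsSelfAdjoint.log), CFC.log_exp _ IsSelfAdjoint.log,
    CFC.log_exp _ IsSelfAdjoint.log]

lemma tr_mul_log_nonpos {ρ : H →L[ℂ] H} (hρ : IsState ρ) (hρp : IsStrictlyPositive ρ) :
    (tr (ρ * CFC.log ρ)).re ≤ 0 := by
  have h1 := CFC.log_le_log (isState_le_one hρ) hρp
  rw [CFC.log_one] at h1
  have h2 := tr_mul_re_le hρ.1 h1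
  rwa [mul_zero, tr_zero, Complex.zero_re] at h2

lemma log_minEigenvalue_le_tr [Nontrivial H] {ρ s : H →L[ℂ] H} (hρ : IsState ρ)
    (hs : IsStrictlyPositive s) : Real.log (minEigenvalue s) ≤ (tr (ρ * CFC.log s)).re := by
  have hpos := minEigenvalue_pos hs
  have h1 := CFC.log_le_log (algebraMap_minEigenvalue_le (IsSelfAdjoint.of_nonneg hs.nonneg))
    (IsStrictlyPositive.iff_of_unital.2
      ⟨algebraMap_nonneg _ hpos.le, (IsUnit.mk0 _ hpos.ne').map _⟩)
  rw [CFC.log_algebraMap] at h1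
  have h2 := tr_mul_re_le hρ.1 h1
  rwa [Algebra.algebraMap_eq_smul_one, mul_smul_comm, mul_one, tr_real_smul, hρ.2, mul_one,
    Complex.ofReal_re] at h2

lemma continuousAt_log {R : ℝ → H →L[ℂ] H} {r : ℝ} (hp : ∀ u, IsStrictlyPositive (R u))
    (hc : ContinuousAt R r) : ContinuousAt (fun u => CFC.log (R u)) r := by
  have hmem : ∀ u, R u ∈ {a : H →L[ℂ] H | IsSelfAdjoint a ∧ IsUnit a} := fun u =>
    ⟨IsSelfAdjoint.of_nonneg (hp u).nonneg, (hp u).isUnit⟩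
  exact (CFC.continuousOn_log (A := H →L[ℂ] H) (R r) (hmem r)).tendsto.comp
    (tendsto_nhdsWithin_iff.2 ⟨hc, Eventually.of_forall hmem⟩)

/-- The derivative of `Tr[ρ log ρ]` along a path of faithful states is `Tr[ρ' log ρ]`. Klein's
inequality, for the two orders of the arguments, encloses the increment of `Tr[ρ log ρ]` between
`Tr[Δρ log ρ]` at the two end points, so that only the continuity of `log` is needed. -/
lemma hasDerivAt_tr_mul_log {R : ℝ → H →L[ℂ] H} {R' : H →L[ℂ] H} {r : ℝ}
    (hp : ∀ u, IsStrictlyPositive (R u)) (h1 : ∀ u, tr (R u) = 1) (hd : HasDerivAt R R' r) :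
    HasDerivAt (fun u => (tr (R u * CFC.log (R u))).re) (tr (R' * CFC.log (R r))).re r := by
  have hlin : HasDerivAt (fun u => (tr (R u * CFC.log (R r))).re) (tr (R' * CFC.log (R r))).re r :=
    hasDerivAt_re_tr (hd.mul_const _)
  let h : ℝ → ℝ := fun u => (tr (R u * (CFC.log (R u) - CFC.log (R r)))).re
  suffices hh : HasDerivAt h 0 r by
    have h2 := hh.fun_add hlin
    rw [zero_add] at h2
    refine h2.congr_of_eventuallyEq (Eventually.of_forall fun u => ?_)
    simp only [h, mul_sub, tr_sub, Complex.sub_re]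
    ring
  have hlog : Tendsto (fun u => CFC.log (R u) - CFC.log (R r)) (𝓝 r) (𝓝 0) := by
    have h4 := continuousAt_log hp hd.continuousAt
    simpa using h4.tendsto.sub_const (CFC.log (R r))
  rw [hasDerivAt_iff_isLittleO]
  have hO : (fun u => ‖R u - R r‖) =O[𝓝 r] fun u => u - r := hd.isBigO_sub.norm_left
  have hmul := hO.mul_isLittleO (Asymptotics.isLittleO_one_iff ℝ |>.2 hlog).norm_left
  simp only [mul_one] at hmul
  -- `0 ≤ h u ≤ Tr[(R u - R r) (log (R u) - log (R r))]`, which is `O(u - r) * o(1)`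
  refine (Asymptotics.IsBigO.of_bound ‖trCLM (H := H)‖
    (Eventually.of_forall fun u => ?_)).trans_isLittleO hmul
  have hr0 : h r = 0 := by simp [h]
  rw [hr0, smul_zero, sub_zero, sub_zero, Real.norm_of_nonneg
    (relEntropy_nonneg (hp u) (hp r) (h1 u) (h1 r))]
  have h5 : h u ≤ (tr ((R u - R r) * (CFC.log (R u) - CFC.log (R r)))).re := by
    have h6 := relEntropy_nonneg (hp r) (hp u) (h1 r) (h1 u)
    simp only [h, mul_sub, sub_mul, tr_sub, Complex.sub_re] at h6 ⊢
    linarith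
  refine h5.trans ((Complex.re_le_norm _).trans ?_)
  refine ((trCLM (H := H)).le_opNorm _).trans ?_
  rw [Real.norm_of_nonneg (by positivity)]
  exact mul_le_mul_of_nonneg_left (norm_mul_le _ _) (norm_nonneg _)

lemma eq_zero_of_traceNorm_eq_zero {A : H →L[ℂ] H} (h : traceNorm A = 0) : A = 0 := by
  have h1 : 0 ≤ CFC.abs A := CFC.abs_nonneg A
  have h2 : tr (CFC.abs A) = 0 :=
    Complex.ext h (Complex.nonneg_iff.1 (tr_nonneg h1)).2.symm
  obtain ⟨c, hc⟩ := exists_eq_star_mul_self h1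
  rw [hc] at h2
  have h3 := eq_zero_of_tr_star_mul_self h2
  rw [h3, mul_zero] at hc
  exact CFC.abs_eq_zero_iff.1 hc

variable {P : QuantumMarkovSemigroup H} {σ : H →L[ℂ] H} {E : (H →L[ℂ] H) →CP (H →L[ℂ] H)}

lemma predualMap_isStrictlyPositive (hσ : IsInvariantState P σ) (hf : IsStrictlyPositive σ)
    {ρ : H →L[ℂ] H} (hρ : IsStrictlyPositive ρ) (t : ℝ≥0) :
    IsStrictlyPositive (predualMap P t ρ) := by
  refine isStrictlyPositive_of_tr (predualMap_nonneg hρ.nonneg t) fun X hX h => ?_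
  rw [tr_mul_predualMap, tr_mul_comm] at h
  have h1 := eq_zero_of_tr_mul_eq_zero hρ (cp_nonneg _ hX) h
  refine eq_zero_of_tr_mul_eq_zero hf hX ?_
  rw [← hσ.2 t, h1, mul_zero, tr_zero]

lemma predualExp_isStrictlyPositive (hE : IsDFExpectation P σ E) (hf : IsStrictlyPositive σ)
    {ρ : H →L[ℂ] H} (hρ : IsStrictlyPositive ρ) : IsStrictlyPositive (predualExp E ρ) := by
  refine isStrictlyPositive_of_tr (predualExp_nonneg hρ.nonneg) fun X hX h => ?_
  rw [tr_mul_predualExp, tr_mul_comm] at h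
  have h1 := eq_zero_of_tr_mul_eq_zero hρ (cp_nonneg _ hX) h
  refine eq_zero_of_tr_mul_eq_zero hf hX ?_
  rw [← hE.compatible, h1, mul_zero, tr_zero]

variable [Nontrivial H]

/-- For faithful `ρ` the density is invertible; as it commutes with the reference state, the
logarithm of `E_*(ρ)` splits. -/
lemma exists_log_density (hE : IsDFExpectation P σ E) (hf : IsStrictlyPositive σ)
    {ρ : H →L[ℂ] H} (hρ : IsStrictlyPositive ρ) : ∃ ω ∈ dfAlgebra P, IsStrictlyPositive ω ∧
      refState E * ω = predualExp E ρ ∧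
      CFC.log (predualExp E ρ) = CFC.log (refState E) + CFC.log ω := by
  obtain ⟨ω, hω, hω0, h⟩ := exists_density hE hf hρ.nonneg
  have hs := refState_isStrictlyPositive hE hf
  have hu : IsUnit ω := by
    have h1 := (predualExp_isStrictlyPositive hE hf hρ).isUnit
    rw [← h] at h1
    have h2 : ω = Ring.inverse (refState E) * (refState E * ω) := by
      rw [Ring.inverse_mul_cancel_left _ _ hs.isUnit]
    rw [h2]
    exact hs.isUnit.ringInverse.mul h1
  have hp : IsStrictlyPositive ω := IsStrictlyPositive.iff_of_unital.2 ⟨hω0, hu⟩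
  exact ⟨ω, hω, hp, h, by rw [← h, log_mul_of_commute hs hp (refState_commute hE hω)]⟩

/-- The relative entropy to the conditional expectation is at most `log (1 / σ_min)`: it is
`Tr[ρ log ρ] - Tr[ρ log σ_Tr]` minus the relative entropy of the conditional expectation to the
reference state. -/
lemma entropy_le_log (hE : IsDFExpectation P σ E) (hf : IsStrictlyPositive σ)
    {ρ : H →L[ℂ] H} (hρ : IsState ρ) (hρp : IsStrictlyPositive ρ) :
    (tr (ρ * (CFC.log ρ - CFC.log (predualExp E ρ)))).re ≤
      Real.log (1 / minEigenvalue (refState E)) := by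
  obtain ⟨ω, hω, hωp, -, hlog⟩ := exists_log_density hE hf hρp
  have hs := refState_isStrictlyPositive hE hf
  have hlω : CFC.log ω ∈ dfAlgebra P :=
    cfc_mem_dfAlgebra hω (IsSelfAdjoint.of_nonneg hωp.nonneg) _
  have h1 : tr (ρ * CFC.log ω) = tr (predualExp E ρ * CFC.log ω) := by
    rw [tr_mul_comm, tr_mul_comm (predualExp E ρ), tr_mul_predualExp, hE.apply_of_mem hlω]
  have h2 := relEntropy_nonneg (predualExp_isStrictlyPositive hE hf hρp) hs
    (predualExp_isState hE hρ).2 (tr_refState hE)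
  rw [hlog, add_sub_cancel_left, ← h1] at h2
  have h3 := tr_mul_log_nonpos hρ hρp
  have h4 := log_minEigenvalue_le_tr hρ hs
  rw [hlog, mul_sub, mul_add, tr_sub, tr_add, Complex.sub_re, Complex.add_re, one_div, Real.log_inv]
  linarith

/-- The automorphism `P_t` of the decoherence-free algebra maps the density of `E_*(P_{*t}(ρ))` to
that of `E_*(ρ)`, so the expectation of the logarithm of the density is a constant of
the motion. -/
lemma tr_mul_log_density (hσ : IsInvariantState P σ) (hE : IsDFExpectation P σ E)
    (hf : IsStrictlyPositive σ) {ρ ω ω' : H →L[ℂ] H} (t : ℝ≥0) (hω : ω ∈ dfAlgebra P)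
    (h : refState E * ω = predualExp E ρ) (hω' : ω' ∈ dfAlgebra P) (hs' : IsSelfAdjoint ω')
    (h' : refState E * ω' = predualExp E (predualMap P t ρ)) :
    tr (predualMap P t ρ * CFC.log ω') = tr (ρ * CFC.log ω) := by
  obtain ⟨b, hb, hbω⟩ := exists_map_eq_of_mem hσ hf hω t
  have hbω' : b = ω' := by
    refine (refState_isStrictlyPositive hE hf).isUnit.mul_left_cancel (ext_tr_mul fun X => ?_)
    calc tr (X * (refState E * b)) = tr (refState E * (b * X)) := by
          rw [tr_mul_comm, mul_assoc]
      _ = tr (refState E * (ω * P.map t (E X))) := by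
          rw [← tr_refState_mul_apply hE, hE.map_mul_left hb, ← tr_refState_mul_map hE t,
            map_mul_of_mem_left hb, hbω]
      _ = tr (X * (refState E * ω')) := by
          rw [← mul_assoc, h, tr_mul_comm, tr_mul_predualExp, hE.comm, hE.idempotent, h',
            tr_mul_predualExp, tr_mul_predualMap]
  rw [tr_mul_comm, tr_mul_predualMap, CFC.log, map_cfc_of_mem hω' hs', ← hbω', hbω, tr_mul_comm,
    CFC.log]

/-- Along the evolution, the relative entropy to the conditional expectation differs from the
relative entropy to the reference state by a constant. -/
lemma exists_entropy_eq_sub_const (hσ : IsInvariantState P σ) (hE : IsDFExpectation P σ E)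
    (hf : IsStrictlyPositive σ) {ρ : H →L[ℂ] H} (hρp : IsStrictlyPositive ρ) :
    ∃ C : ℝ, ∀ u : ℝ, (tr (predualMap P u.toNNReal ρ * (CFC.log (predualMap P u.toNNReal ρ) -
      CFC.log (predualExp E (predualMap P u.toNNReal ρ))))).re =
      (tr (predualMap P u.toNNReal ρ * CFC.log (predualMap P u.toNNReal ρ))).re -
      (tr (predualMap P u.toNNReal ρ * CFC.log (refState E))).re - C := by
  obtain ⟨ω, hω, hωp, hωρ, -⟩ := exists_log_density hE hf hρp
  refine ⟨(tr (ρ * CFC.log ω)).re, fun u => ?_⟩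
  obtain ⟨ω', hω', hωp', hωρ', hlog⟩ := exists_log_density hE hf
    (predualMap_isStrictlyPositive hσ hf hρp u.toNNReal)
  rw [hlog, ← tr_mul_log_density hσ hE hf u.toNNReal hω hωρ hω'
    (IsSelfAdjoint.of_nonneg hωp'.nonneg) hωρ']
  simp only [mul_sub, mul_add, tr_sub, tr_add, Complex.sub_re, Complex.add_re]
  ring

lemma dfEntropy_eq_coe (hE : IsDFExpectation P σ E) (hf : IsStrictlyPositive σ)
    {ρ : H →L[ℂ] H} (hρp : IsStrictlyPositive ρ) :
    dfEntropy E ρ = ((tr (ρ * (CFC.log ρ - CFC.log (predualExp E ρ)))).re : EReal) := by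
  rw [dfEntropy, relEntropy, if_pos]
  intro x hx
  have h := (predualExp_isStrictlyPositive hE hf hρp).isUnit
  have h1 : x = (Ring.inverse (predualExp E ρ) * predualExp E ρ) x := by
    rw [Ring.inverse_mul_cancel _ h, one_apply_eq_self]
  rw [h1, mul_apply_eq_comp, hx, map_zero, map_zero]

lemma entropyProduction_eq_coe {ρ : H →L[ℂ] H} (hρp : IsStrictlyPositive ρ) :
    entropyProduction P E ρ =
      ((-(tr (predualLindbladian P ρ * (CFC.log ρ - CFC.log (refState E)))).re : ℝ) : EReal) := by
  rw [entropyProduction, if_pos]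
  intro x hx
  have h1 : x = (Ring.inverse ρ * ρ) x := by
    rw [Ring.inverse_mul_cancel _ hρp.isUnit, one_apply_eq_self]
  rw [h1, mul_apply_eq_comp, hx, map_zero, inner_zero_left]

/-- The modified decoherence-free logarithmic Sobolev inequality at a faithful state. There
Pinsker's inequality makes the entropy positive, so the quotient in the definition of the constant
is an ordinary quotient of real numbers. -/
lemma mul_entropy_le_entropyProduction (hE : IsDFExpectation P σ E) (hf : IsStrictlyPositive σ)
    {c : ℝ} (hc : (c : EReal) < logSobolevConst P E) {ρ : H →L[ℂ] H} (hρ : IsState ρ)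
    (hρp : IsStrictlyPositive ρ) (hne : ρ ≠ predualExp E ρ) :
    2 * c * (tr (ρ * (CFC.log ρ - CFC.log (predualExp E ρ)))).re ≤
      -(tr (predualLindbladian P ρ * (CFC.log ρ - CFC.log (refState E)))).re := by
  set D := (tr (ρ * (CFC.log ρ - CFC.log (predualExp E ρ)))).re with hD
  set F := -(tr (predualLindbladian P ρ * (CFC.log ρ - CFC.log (refState E)))).re with hF
  have hEp := predualExp_isStrictlyPositive hE hf hρp
  have hpos : 0 < D := by
    have h1 := pinsker hρp hEp hρ.2 (predualExp_isState hE hρ).2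
    have h2 : traceNorm (ρ - predualExp E ρ) ≠ 0 := fun h0 =>
      hne (sub_eq_zero.1 (eq_zero_of_traceNorm_eq_zero h0))
    have h3 : 0 < traceNorm (ρ - predualExp E ρ) ^ 2 := by positivity
    linarith
  have h1 : logSobolevConst P E ≤ entropyProduction P E ρ / (2 * dfEntropy E ρ) :=
    iInf_le_of_le ρ (iInf_le_of_le hρ (iInf_le _ hne))
  have h2 := hc.trans_le h1
  rw [entropyProduction_eq_coe hρp, dfEntropy_eq_coe hE hf hρp, ← hF, ← hD] at h2
  have h3 : (2 : EReal) * (D : EReal) = ((2 * D : ℝ) : EReal) := by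
    rw [EReal.coe_mul]; rfl
  rw [h3, ← EReal.coe_div, EReal.coe_lt_coe_iff, lt_div_iff₀ (by positivity)] at h2
  linarith

/-- Exponential decay of the relative entropy for faithful states. -/
theorem entropy_le_exp (hσ : IsInvariantState P σ) (hE : IsDFExpectation P σ E)
    (hf : IsStrictlyPositive σ) {c : ℝ} (hc : (c : EReal) < logSobolevConst P E)
    {ρ : H →L[ℂ] H} (hρ : IsState ρ) (hρp : IsStrictlyPositive ρ) (t : ℝ≥0) :
    (tr (predualMap P t ρ * (CFC.log (predualMap P t ρ) -
      CFC.log (predualExp E (predualMap P t ρ))))).re ≤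
      Real.log (1 / minEigenvalue (refState E)) * Real.exp (-(2 * c * t)) := by
  let R : ℝ → H →L[ℂ] H := fun u => predualMap P u.toNNReal ρ
  have hRp : ∀ u, IsStrictlyPositive (R u) := fun u => predualMap_isStrictlyPositive hσ hf hρp _
  have hRs : ∀ u, IsState (R u) := fun u => predualMap_isState hρ _
  have hRc : Continuous R := (continuous_predualMap P ρ).comp continuous_real_toNNReal
  let g : ℝ → ℝ := fun u => (tr (R u * (CFC.log (R u) - CFC.log (predualExp E (R u))))).re
  obtain ⟨C, hC⟩ := exists_entropy_eq_sub_const hσ hE hf hρp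
  have hg : g = fun u => (tr (R u * CFC.log (R u))).re -
      (tr (R u * CFC.log (refState E))).re - C := funext hC
  have hg0 : ∀ u, 0 ≤ g u := fun u => relEntropy_nonneg (hRp u)
    (predualExp_isStrictlyPositive hE hf (hRp u)) (hRs u).2 (predualExp_isState hE (hRs u)).2
  have hgc : ContinuousOn g (Ici 0) := by
    refine Continuous.continuousOn ?_
    have hl : Continuous fun u => CFC.log (R u) :=
      continuous_iff_continuousAt.2 fun u => continuousAt_log hRp hRc.continuousAt
    rw [hg]
    exact ((Complex.continuous_re.comp (continuous_tr.comp (hRc.mul hl))).sub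
      (Complex.continuous_re.comp (continuous_tr.comp (hRc.mul continuous_const)))).sub
        continuous_const
  have hgd : ∀ u, 0 < u → HasDerivAt g (tr (predualLindbladian P (R u) *
      (CFC.log (R u) - CFC.log (refState E)))).re u := by
    intro u hu
    have hd := hasDerivAt_predualMap P ρ hu
    have h1 := hasDerivAt_tr_mul_log hRp (fun u => (hRs u).2) hd
    have h2 : HasDerivAt (fun u => (tr (R u * CFC.log (refState E))).re)
        (tr (predualLindbladian P (R u) * CFC.log (refState E))).re u :=
      hasDerivAt_re_tr (hd.mul_const _)
    rw [hg]
    refine ((h1.fun_sub h2).sub_const C).congr_deriv ?_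
    rw [mul_sub, tr_sub, Complex.sub_re]
  have hineq : ∀ u, 0 < u → (tr (predualLindbladian P (R u) *
      (CFC.log (R u) - CFC.log (refState E)))).re ≤ -(2 * c) * g u := by
    intro u hu
    by_cases hne : R u = predualExp E (R u)
    · -- here the entropy vanishes, so `u` is a minimum
      have h0 : g u = 0 := by simp only [g]; rw [← hne]; simp
      have hmin : IsLocalMin g u := Eventually.of_forall fun v => h0 ▸ hg0 v
      rw [hmin.hasDerivAt_eq_zero (hgd u hu), h0, mul_zero]
    · have h1 := mul_entropy_le_entropyProduction hE hf hc (hRs u) (hRp u) hne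
      simp only [g]
      linarith
  have hdecay := le_mul_exp_of_deriv_le hgc hgd hineq t.2
  have hinit : g 0 ≤ Real.log (1 / minEigenvalue (refState E)) :=
    entropy_le_log hE hf (hRs 0) (hRp 0)
  have h1 := hdecay.trans (mul_le_mul_of_nonneg_right hinit (Real.exp_nonneg _))
  have h2 : g t = (tr (predualMap P t ρ * (CFC.log (predualMap P t ρ) -
      CFC.log (predualExp E (predualMap P t ρ))))).re := by
    simp only [g, R, Real.toNNReal_coe]
  rw [← h2]
  exact h1

end Entropy

/-! ### Trace norm bounds from the logarithmic Sobolev inequality -/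

section LogSobolev

open scoped ComplexOrder
open Filter Set

variable {H : Type*} [NormedAddCommGroup H] [InnerProductSpace ℂ H] [CompleteSpace H]
  [FiniteDimensional ℂ H] {P : QuantumMarkovSemigroup H} {σ : H →L[ℂ] H}
  {E : (H →L[ℂ] H) →CP (H →L[ℂ] H)}

lemma traceNorm_smul {c : ℝ} (hc : 0 ≤ c) (X : H →L[ℂ] H) :
    traceNorm ((c : ℂ) • X) = c * traceNorm X := by
  rw [traceNorm, CFC.abs_smul, tr_real_smul, Complex.norm_real, Real.norm_of_nonneg hc,
    Complex.re_ofReal_mul, traceNorm]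

lemma predualExp_refState (hE : IsDFExpectation P σ E) :
    predualExp E (refState E) = refState E :=
  ext_tr_mul fun X => by
    rw [tr_mul_predualExp, tr_mul_comm, tr_refState_mul_apply hE, tr_mul_comm]

variable [Nontrivial H]

/-- Faithful states are dense: a bound on `‖P_{*t}(ρ - E_*(ρ))‖` for faithful states extends to all
states, by mixing with the reference state, which is fixed by `E_*`. -/
lemma traceNorm_le_of_faithful (hE : IsDFExpectation P σ E) (hf : IsStrictlyPositive σ)
    {B : ℝ} {t : ℝ≥0} (h : ∀ ρ : H →L[ℂ] H, IsState ρ → IsStrictlyPositive ρ →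
      traceNorm (predualMap P t (ρ - predualExp E ρ)) ≤ B) {ρ : H →L[ℂ] H} (hρ : IsState ρ) :
    traceNorm (predualMap P t (ρ - predualExp E ρ)) ≤ B := by
  have hs := refState_isState hE
  have hsp := refState_isStrictlyPositive hE hf
  have hε : ∀ ε : ℝ, 0 < ε → ε < 1 →
      (1 - ε) * traceNorm (predualMap P t (ρ - predualExp E ρ)) ≤ B := by
    intro ε h0 h1
    set ρ' : H →L[ℂ] H := ((1 - ε : ℝ) : ℂ) • ρ + (ε : ℂ) • refState E with hρ'
    have hnn : 0 ≤ ((1 - ε : ℝ) : ℂ) • ρ :=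
      smul_nonneg (Complex.zero_le_real.2 (by linarith)) hρ.1
    have hεp : IsStrictlyPositive ((ε : ℂ) • refState E) := by
      refine IsStrictlyPositive.iff_of_unital.2
        ⟨smul_nonneg (Complex.zero_le_real.2 h0.le) hs.1, ?_⟩
      have hne : (ε : ℂ) ≠ 0 := Complex.ofReal_ne_zero.2 h0.ne'
      exact (isUnit_smul_iff (Units.mk0 (ε : ℂ) hne) (refState E)).2 hsp.isUnit
    have hstate : IsState ρ' := by
      refine ⟨add_nonneg hnn hεp.nonneg, ?_⟩
      rw [hρ', tr_add, tr_smul, tr_smul, hρ.2, hs.2]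
      push_cast
      ring
    have h2 := h ρ' hstate (hεp.nonneg_add hnn)
    have h3 : ρ' - predualExp E ρ' = ((1 - ε : ℝ) : ℂ) • (ρ - predualExp E ρ) := by
      rw [hρ', map_add, map_smul, map_smul, predualExp_refState hE, smul_sub]
      abel
    rwa [h3, map_smul, traceNorm_smul (by linarith)] at h2
  have hlim : Tendsto (fun ε : ℝ => (1 - ε) * traceNorm (predualMap P t (ρ - predualExp E ρ)))
      (𝓝[>] 0) (𝓝 ((1 - 0) * traceNorm (predualMap P t (ρ - predualExp E ρ)))) :=
    (Continuous.tendsto (by fun_prop) 0).mono_left nhdsWithin_le_nhds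
  rw [sub_zero, one_mul] at hlim
  refine le_of_tendsto hlim ?_
  filter_upwards [Ioo_mem_nhdsGT (one_pos : (0 : ℝ) < 1)] with ε h
  exact hε ε h.1 h.2

/-- Pinsker's inequality along the evolution, which commutes with `E_*`. -/
lemma sq_traceNorm_le_entropy (hσ : IsInvariantState P σ) (hE : IsDFExpectation P σ E)
    (hf : IsStrictlyPositive σ) {ρ : H →L[ℂ] H} (hρ : IsState ρ) (hρp : IsStrictlyPositive ρ)
    (t : ℝ≥0) : traceNorm (predualMap P t (ρ - predualExp E ρ)) ^ 2 ≤
      2 * (tr (predualMap P t ρ * (CFC.log (predualMap P t ρ) -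
        CFC.log (predualExp E (predualMap P t ρ))))).re := by
  have hp := predualMap_isStrictlyPositive hσ hf hρp t
  have hs := predualMap_isState (P := P) hρ t
  rw [map_sub, predualMap_predualExp hE]
  exact pinsker hp (predualExp_isStrictlyPositive hE hf hp) hs.2 (predualExp_isState hE hs).2

/-- Convergence in trace norm at every rate below the logarithmic Sobolev constant: Pinsker's
inequality applied to the exponential decay of the relative entropy. -/
theorem traceNorm_le_of_logSobolev (hσ : IsInvariantState P σ) (hE : IsDFExpectation P σ E)
    (hf : IsStrictlyPositive σ) {c : ℝ} (hc : (c : EReal) < logSobolevConst P E)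
    {ρ : H →L[ℂ] H} (hρ : IsState ρ) (t : ℝ≥0) :
    traceNorm (predualMap P t (ρ - predualExp E ρ)) ≤
      Real.sqrt (2 * Real.log (1 / minEigenvalue (refState E))) * Real.exp (-(c * t)) := by
  refine traceNorm_le_of_faithful hE hf (fun ρ hρ hρp => ?_) hρ
  have h1 := sq_traceNorm_le_entropy hσ hE hf hρ hρp t
  have h2 := entropy_le_exp hσ hE hf hc hρ hρp t
  have h3 : Real.exp (-(2 * c * t)) = Real.exp (-(c * t)) ^ 2 := by
    rw [← Real.exp_nat_mul]
    congr 1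
    push_cast
    ring
  have h4 : Real.sqrt (2 * Real.log (1 / minEigenvalue (refState E))) * Real.exp (-(c * t)) =
      Real.sqrt (2 * Real.log (1 / minEigenvalue (refState E)) * Real.exp (-(c * t)) ^ 2) := by
    rw [Real.sqrt_mul' _ (sq_nonneg (Real.exp (-(c * t)))), Real.sqrt_sq (Real.exp_nonneg _)]
  rw [h4]
  refine Real.le_sqrt_of_sq_le ?_
  rw [h3] at h2
  linarith

/-- The bound without decay, which needs no logarithmic Sobolev inequality. -/
theorem traceNorm_le_sqrt_log (hσ : IsInvariantState P σ) (hE : IsDFExpectation P σ E)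
    (hf : IsStrictlyPositive σ) {ρ : H →L[ℂ] H} (hρ : IsState ρ) (t : ℝ≥0) :
    traceNorm (predualMap P t (ρ - predualExp E ρ)) ≤
      Real.sqrt (2 * Real.log (1 / minEigenvalue (refState E))) := by
  refine traceNorm_le_of_faithful hE hf (fun ρ hρ hρp => ?_) hρ
  have h1 := sq_traceNorm_le_entropy hσ hE hf hρ hρp t
  have h2 := entropy_le_log hE hf (predualMap_isState hρ t)
    (predualMap_isStrictlyPositive hσ hf hρp t)
  exact Real.le_sqrt_of_sq_le (by linarith)

/-- The Poincaré inequality holds for every rate below the best constant, as the variance is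
nonnegative. -/
lemma exists_poincare_of_lt {c : ℝ} (hc : (c : EReal) < poincareConst P E) :
    ∀ X : H →L[ℂ] H, IsSelfAdjoint X → c * dfVariance E X ≤ dirichletForm P E X := by
  obtain ⟨_, ⟨c', rfl, h⟩, hcc⟩ := lt_sSup_iff.1 hc
  intro X hX
  exact (mul_le_mul_of_nonneg_right (EReal.coe_lt_coe_iff.1 hcc).le
    (weightedInner_self_nonneg _)).trans (h X hX)

end LogSobolev

end QMS

theorem theorem6p2 {H : Type*} [NormedAddCommGroup H] [InnerProductSpace ℂ H] [CompleteSpace H]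
    [FiniteDimensional ℂ H] (P : QuantumMarkovSemigroup H)
    (σ : H →L[ℂ] H) (hσ : QMS.IsInvariantState P σ) (hσ_faithful : IsStrictlyPositive σ) :
    (∃! E : (H →L[ℂ] H) →CP (H →L[ℂ] H), QMS.IsDFExpectation P σ E) ∧
    ∀ E : (H →L[ℂ] H) →CP (H →L[ℂ] H), QMS.IsDFExpectation P σ E →
      ∀ ρ : H →L[ℂ] H, QMS.IsState ρ → ∀ t : ℝ≥0,
        ENNReal.ofReal (QMS.traceNorm (QMS.predualMap P t (ρ - QMS.predualExp E ρ))) ≤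
          ENNReal.ofReal (Real.sqrt (1 / QMS.minEigenvalue (QMS.refState E))) *
            EReal.exp (-(QMS.poincareConst P E * ((t : ℝ) : EReal))) ∧
        ENNReal.ofReal (QMS.traceNorm (QMS.predualMap P t (ρ - QMS.predualExp E ρ))) ≤
          ENNReal.ofReal
              (Real.sqrt (2 * Real.log (1 / QMS.minEigenvalue (QMS.refState E)))) *
            EReal.exp (-(QMS.logSobolevConst P E * ((t : ℝ) : EReal))) := by
  -- on the zero space no operator has trace one
  have hH : Nontrivial H := by
    by_contra hH
    rw [not_nontrivial_iff_subsingleton] at hH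
    have h1 : σ = 0 := Subsingleton.elim _ _
    have h2 := hσ.1.2
    rw [h1, QMS.tr_zero] at h2
    exact zero_ne_one h2
  refine ⟨QMS.existsUnique_dfExpectation hσ hσ_faithful, fun E hE ρ hρ t => ⟨?_, ?_⟩⟩
  · exact QMS.ofReal_le_mul_exp (Real.sqrt_nonneg _)
      (QMS.traceNorm_le_sqrt hE hσ_faithful hρ t) fun c hc =>
        QMS.traceNorm_le_of_poincare hE hσ_faithful (QMS.exists_poincare_of_lt hc) hρ t
  · exact QMS.ofReal_le_mul_exp (Real.sqrt_nonneg _)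
      (QMS.traceNorm_le_sqrt_log hσ hE hσ_faithful hρ t) fun c hc =>
        QMS.traceNorm_le_of_logSobolev hσ hE hσ_faithful hc hρ t
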